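/- Let $\mathbb F_q$ be a finite field. For integers $\ell,k\ge 0$ let $\mathcal V(\ell,k)=H^0(F_k,\mathcal O(3,\ell))$, where $F_k=\mathbb P(\mathcal O\oplus\mathcal O(-k))\to\mathbb P^1_{\mathbb F_q}$ is the Hirzebruch surface; explicitly, $\mathcal V(\ell,k)$ is the finite $\mathbb F_q$-vector space of binary cubic forms $$s=A_0x^3+A_1x^2y+A_2xy^2+A_3y^3,$$ where $A_i\in\mathbb F_q[t_0,t_1]$ is homogeneous of degree $\ell-ik$ (and $A_i=0$ if $\ell-ik<0$). The form $s$ is called horizontally reducible if $s=0$ or if $s=(B_0x^2+B_1xy+B_2y^2)(C_0x+C_1y)$ with both factors nonzero and, for some integers $b,c$, with $B_i,C_i\in\mathbb F_q[t_0,t_1]$ homogeneous of degrees $b-ik$ and $c-ik$ respectively (zero if this degree is negative). Otherwise $s$ is horizontally irreducible. Let $\mathcal V(\ell,k)^{\mathrm{ir}}\subseteq\mathcal V(\ell,k)$ be the subset of horizontally irreducible forms. For a closed point $P\in\mathbb P^1_{\mathbb F_q}$ with residue field $\kappa(P)$, let $r_P(s)$ be the number of roots $(x:y)\in\mathbb P^1(\kappa(P))$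 of the restriction $s|_P$ of $s$ to the fibre above $P$. A reduced effective divisor $D$ on $\mathbb P^1_{\mathbb F_q}$ is a finite set of closed points; write $\omega(D)$ for their number and $\deg D=\sum_{P\mid D}[\kappa(P):\mathbb F_q]$. Put $$a_D(s)=\prod_{P\mid D}\bigl(r_P(s)-1\bigr),\qquad \Phi^{\mathrm{ir}}(\ell,k,D)=\sum_{s\in\mathcal V(\ell,k)^{\mathrm{ir}}}a_D(s).$$ Then there is a constant $K$, depending only on the field $\mathbb F_q$, such that for all integers $\ell,k\ge 0$ and all reduced effective divisors $D$ on $\mathbb P^1_{\mathbb F_q}$ with $\ell\ge 3k$ and $\ell-2k\ge\frac{\deg D+k}{2}$, $$\left|\Phi^{\mathrm{ir}}(\ell,k,D)-q^{4\ell-6k+4-\deg D}\right|\le K\cdot 6^{\omega(D)}q^{3\ell-3k}.$$ -/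

import Mathlib

noncomputable section

namespace HirzebruchCubic

open MvPolynomial

universe u

/-! ### Sections on the projective line and on Hirzebruch surfaces -/

/-- `H⁰(ℙ¹, 𝒪(n))`: the homogeneous polynomials of degree `n` in `F[t₀, t₁]`
(only the zero polynomial when `n < 0`). -/
def lineSections (F : Type u) [Field F] (n : ℤ) : Submodule F (MvPolynomial (Fin 2) F) :=
  if 0 ≤ n then homogeneousSubmodule (Fin 2) F n.toNat else ⊥

/-- `H⁰(F_k, 𝒪(m, ℓ))` for the Hirzebruch surface `F_k = ℙ(𝒪 x ⊕ 𝒪(-k) y)`: the section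
`A₀ x^m + A₁ x^(m-1) y + ⋯ + A_m y^m`, where `Aᵢ ∈ F[t₀, t₁]` is homogeneous of degree `ℓ - i k`,
is recorded by its coefficients `(A₀, …, A_m)`. -/
def surfaceSections (F : Type u) [Field F] (k m : ℕ) (ℓ : ℤ) :
    Submodule F (Fin (m + 1) → MvPolynomial (Fin 2) F) :=
  Submodule.pi Set.univ fun i => lineSections F (ℓ - (i : ℕ) * k)

/-- The binary form `A₀ x^m + A₁ x^(m-1) y + ⋯ + A_m y^m` in the variables `x = X 0`, `y = X 1`. -/
def binaryForm {R : Type u} [CommRing R] {m : ℕ} (A : Fin (m + 1) → R) : MvPolynomial (Fin 2) R :=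
  ∑ i : Fin (m + 1), C (A i) * X 0 ^ (m - (i : ℕ)) * X 1 ^ (i : ℕ)

/-- `𝒱(ℓ, k) = H⁰(F_k, 𝒪(3, ℓ))`: binary cubic forms `A₀ x³ + A₁ x² y + A₂ x y² + A₃ y³` with
`Aᵢ ∈ F[t₀, t₁]` homogeneous of degree `ℓ - i k`. -/
abbrev cubicForms (F : Type u) [Field F] (ℓ k : ℕ) :
    Submodule F (Fin 4 → MvPolynomial (Fin 2) F) :=
  surfaceSections F k 3 ℓ

/-- A binary cubic form on `F_k` is horizontally reducible if it is zero or it is the product of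
nonzero sections `B₀ x² + B₁ x y + B₂ y²` of `𝒪(2, b)` and `C₀ x + C₁ y` of `𝒪(1, c)`, for some
integers `b` and `c`. -/
def HorizontallyReducible {F : Type u} [Field F] (k : ℕ)
    (s : Fin 4 → MvPolynomial (Fin 2) F) : Prop :=
  s = 0 ∨ ∃ b c : ℤ, ∃ B ∈ surfaceSections F k 2 b, ∃ L ∈ surfaceSections F k 1 c,
    B ≠ 0 ∧ L ≠ 0 ∧ binaryForm s = binaryForm B * binaryForm L

/-- `𝒱(ℓ, k)^ir`: the horizontally irreducible forms in `𝒱(ℓ, k)`. -/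
def irreducibleCubicForms (F : Type u) [Field F] (ℓ k : ℕ) :
    Set (Fin 4 → MvPolynomial (Fin 2) F) :=
  {s | s ∈ cubicForms F ℓ k ∧ ¬ HorizontallyReducible k s}

/-! ### Closed points and reduced divisors on the projective line -/

/-- The closed points of `ℙ¹` over `F`, with homogeneous coordinates `(t₀ : t₁)`: the points of the
chart `t₁ ≠ 0`, which are the closed points of `Spec F[t]` with `t = t₀ / t₁` and correspond to the
monic irreducible polynomials, and the point `∞ = (1 : 0)`. -/
inductive ClosedPoint (F : Type u) [Field F] : Type u
  | finite (f : Polynomial F) (monic : f.Monic) (irreducible : Irreducible f) : ClosedPoint F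
  | infinity : ClosedPoint F

namespace ClosedPoint

variable {F : Type u} [Field F]

/-- The equation of a closed point in an affine chart that contains it: the chart with coordinate
`t₀ / t₁` for a finite point, and the chart with coordinate `t₁ / t₀` for `∞`. -/
def equation : ClosedPoint F → Polynomial F
  | finite f _ _ => f
  | infinity => Polynomial.X

instance (P : ClosedPoint F) : Fact (Irreducible P.equation) :=
  ⟨match P with
    | finite _ _ h => h
    | infinity => Polynomial.irreducible_X⟩

/-- The residue field `κ(P)`. -/
abbrev residueField (P : ClosedPoint F) : Type u := AdjoinRoot P.equation

/-- The degree `[κ(P) : F]`. -/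
def degree (P : ClosedPoint F) : ℕ := Module.finrank F P.residueField

/-- Homogeneous coordinates `(t₀ : t₁)` of `P` in `κ(P)`. -/
def coordinates (P : ClosedPoint F) : Fin 2 → P.residueField :=
  match P with
  | finite f h h' => ![AdjoinRoot.root (finite f h h').equation, 1]
  | infinity => ![1, AdjoinRoot.root (infinity : ClosedPoint F).equation]

/-- The restriction `s|_P` to the fibre `ℙ¹` over `κ(P)`: the binary form over `κ(P)` with
coefficients `Aᵢ(P)`. -/
def restrict (P : ClosedPoint F) {m : ℕ} (s : Fin (m + 1) → MvPolynomial (Fin 2) F) :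
    MvPolynomial (Fin 2) P.residueField :=
  binaryForm fun i => aeval P.coordinates (s i)

/-- `r_P(s)`: the number of roots `(x : y) ∈ ℙ¹(κ(P))` of `s|_P`. -/
def rootCount (P : ClosedPoint F) (s : Fin 4 → MvPolynomial (Fin 2) F) : ℕ :=
  Nat.card {z : Projectivization P.residueField (Fin 2 → P.residueField) //
    eval z.rep (P.restrict s) = 0}

end ClosedPoint

/-- A reduced effective divisor on `ℙ¹` is a finite set of closed points; its degree. -/
def divisorDegree {F : Type u} [Field F] (D : Finset (ClosedPoint F)) : ℕ :=
  ∑ P ∈ D, P.degree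

/-- `a_D(s) = ∏_{P ∣ D} (r_P(s) - 1)`. -/
def adjustedRootCount {F : Type u} [Field F] (D : Finset (ClosedPoint F))
    (s : Fin 4 → MvPolynomial (Fin 2) F) : ℤ :=
  ∏ P ∈ D, ((P.rootCount s : ℤ) - 1)

/-! ### The adjusted root-counting function -/

theorem finite_lineSections (F : Type u) [Field F] [Finite F] (n : ℤ) :
    (lineSections F n : Set (MvPolynomial (Fin 2) F)).Finite := by
  have : Module.Finite F (lineSections F n) := by
    rw [Module.Finite.iff_fg, lineSections]
    split_ifs
    · exact homogeneousSubmodule_fg (Fin 2) F n.toNat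
    · exact Submodule.fg_bot
  have : Finite (lineSections F n) := Module.finite_of_finite F
  exact Set.toFinite _

theorem finite_irreducibleCubicForms (F : Type u) [Field F] [Finite F] (ℓ k : ℕ) :
    (irreducibleCubicForms F ℓ k).Finite := by
  refine Set.Finite.subset (Set.Finite.pi' fun i : Fin 4 =>
    finite_lineSections F ((ℓ : ℤ) - (i : ℕ) * k)) ?_
  intro s hs i
  exact hs.1 i (Set.mem_univ i)

/-- `Φ^ir(ℓ, k, D) = ∑ a_D(s)`, the sum being over the finite set of all `s ∈ 𝒱(ℓ, k)^ir`. -/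
def adjustedRootCountingFunction (F : Type u) [Field F] [Finite F] (ℓ k : ℕ)
    (D : Finset (ClosedPoint F)) : ℤ :=
  ∑ s ∈ (finite_irreducibleCubicForms F ℓ k).toFinset, adjustedRootCount D s

end HirzebruchCubic

end

noncomputable section

namespace HirzebruchCubic

open MvPolynomial

universe u

/-! ### Forms on the projective line as polynomials of bounded degree -/

/-! The sum over all cubic forms is computed by Fourier analysis, and the reducible forms are then
removed by a direct count.

All forms. Over a finite field `κ`, the function `r - 1` times `|κ|` is the Fourier transform of the
cone over the twisted cubic (`sum_addChar_conePoint`). Multiplying over `P ∈ D` and summing over the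
space of forms leaves `|𝒱| q^(-deg D)` times the number of families of cone points on `D` orthogonal
to every form (`card_mul_sum_adjustedRootCount`). The zero family gives the main term. A nonzero
orthogonal family is bounded by an elementary form of Serre duality: partial fractions turn it into
four polynomials whose degrees are small by orthogonality (`natDegree_interpolateCone`). The cone
equations hold modulo the modulus of `D`; by the hypothesis on `deg D` both sides have smaller
degree than the modulus, so the equations hold exactly (`interpolateCone_mul_eq`). Polynomial points
of the cone are `(0, 0, 0, g)` or `(g u³, g u² v, g u v², g v³)`, and counting these gives the error
term (`ncard_conePolynomials_le`).

Reducible forms. Since `|r_P - 1|` is at most 2 unless `s` vanishes on the whole fibre, where it is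
`q^(deg P)`, it suffices to count, for each `E ⊆ D`, reducible forms vanishing over `E`
(`abs_sum_adjustedRootCount_le`). Forms with last coefficient zero are counted coefficientwise. Any
other reducible form is a product `B L`, and each point of `E` is a zero of `B` or of `L`; these two
choices give the base `2 (1 + 2) = 6`. -/

theorem natCard_degreeLT (F : Type u) [Field F] [Finite F] (n : ℕ) :
    Nat.card (Polynomial.degreeLT F n) = Nat.card F ^ n := by
  rw [Nat.card_congr (Polynomial.degreeLTEquiv F n).toEquiv, Nat.card_fun, Nat.card_fin]

instance finite_degreeLT (F : Type u) [Field F] [Finite F] (n : ℕ) :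
    Finite (Polynomial.degreeLT F n) :=
  Finite.of_equiv _ (Polynomial.degreeLTEquiv F n).toEquiv.symm

/-- The polynomial `A(t, 1)` attached to a form `A(t₀, t₁)`. -/
def dehomogenize {F : Type u} [Field F] : MvPolynomial (Fin 2) F →ₐ[F] Polynomial F :=
  aeval ![Polynomial.X, 1]

section Line

variable {F : Type u} [Field F]

theorem mem_lineSections_natCast {n : ℕ} {A : MvPolynomial (Fin 2) F} :
    A ∈ lineSections F (n : ℤ) ↔ A.IsHomogeneous n := by
  simp [lineSections, mem_homogeneousSubmodule]

theorem mem_lineSections_of_nonneg {n : ℤ} (hn : 0 ≤ n) {A : MvPolynomial (Fin 2) F} :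
    A ∈ lineSections F n ↔ A.IsHomogeneous n.toNat := by
  simp [lineSections, mem_homogeneousSubmodule, hn]

theorem nonneg_of_mem_lineSections {n : ℤ} {A : MvPolynomial (Fin 2) F}
    (hA : A ∈ lineSections F n) (h0 : A ≠ 0) : 0 ≤ n := by
  by_contra hn
  rw [lineSections, if_neg hn] at hA
  exact h0 (by simpa using hA)

theorem homogenize_dehomogenize {n : ℕ} {A : MvPolynomial (Fin 2) F} (hA : A.IsHomogeneous n) :
    (dehomogenize A).homogenize n = A :=
  Polynomial.homogenize_eq_of_isHomogeneous hA rfl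

theorem natDegree_dehomogenize_le {n : ℕ} {A : MvPolynomial (Fin 2) F}
    (hA : A.IsHomogeneous n) : (dehomogenize A).natDegree ≤ n := by
  rw [A.as_sum, map_sum]
  refine Polynomial.natDegree_sum_le_of_forall_le _ _ fun m hm => ?_
  have h : m.weight 1 = n := hA (by simpa using hm)
  have h2 : m 0 + m 1 = n := by
    rw [← h]
    simp [Finsupp.weight_apply, Finsupp.sum_fintype, Fin.sum_univ_two]
  simp only [dehomogenize, aeval_monomial, ← Polynomial.C_eq_algebraMap]
  refine (Polynomial.natDegree_C_mul_le _ _).trans ?_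
  simp [Finsupp.prod_fintype, Fin.prod_univ_two]
  omega

theorem dehomogenize_homogenize {n : ℕ} {a : Polynomial F} (ha : a.natDegree ≤ n) :
    dehomogenize (a.homogenize n) = a :=
  Polynomial.aeval_homogenize_X_one a ha

theorem dehomogenize_ne_zero {n : ℤ} {A : MvPolynomial (Fin 2) F}
    (hA : A ∈ lineSections F n) (h0 : A ≠ 0) : dehomogenize A ≠ 0 := by
  have hn := nonneg_of_mem_lineSections hA h0
  rw [mem_lineSections_of_nonneg hn] at hA
  intro h
  apply h0
  rw [← homogenize_dehomogenize hA, h, Polynomial.homogenize_zero]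

theorem dehomogenize_injOn (n : ℤ) : Set.InjOn (dehomogenize (F := F)) (lineSections F n) := by
  intro A hA B hB h
  by_contra hne
  exact dehomogenize_ne_zero (sub_mem hA hB) (sub_ne_zero.mpr hne) (by simp [h])

theorem natCard_lineSections [Finite F] (n : ℕ) :
    Nat.card (lineSections F (n : ℤ)) = Nat.card F ^ (n + 1) := by
  rw [← natCard_degreeLT]
  refine Nat.card_congr (Equiv.ofBijective (fun A => ⟨dehomogenize A.1, ?_⟩) ⟨?_, ?_⟩)
  · rw [Polynomial.mem_degreeLT, Polynomial.degree_lt_iff_coeff_zero]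
    intro m hm
    have := natDegree_dehomogenize_le (mem_lineSections_natCast.mp A.2)
    exact Polynomial.coeff_eq_zero_of_natDegree_lt (by omega)
  · intro A B h
    exact Subtype.ext (dehomogenize_injOn _ A.2 B.2 (congrArg Subtype.val h))
  · rintro ⟨a, ha⟩
    rw [Polynomial.degreeLT_succ_eq_degreeLE, Polynomial.mem_degreeLE,
      ← Polynomial.natDegree_le_iff_degree_le] at ha
    exact ⟨⟨a.homogenize n, mem_lineSections_natCast.mpr (Polynomial.isHomogeneous_homogenize a)⟩,
      Subtype.ext (dehomogenize_homogenize ha)⟩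

end Line

/-! ### Closed points -/

namespace ClosedPoint

variable {F : Type u} [Field F]

theorem equation_monic (P : ClosedPoint F) : P.equation.Monic := by
  cases P with
  | finite f h _ => exact h
  | infinity => exact Polynomial.monic_X

theorem equation_irreducible (P : ClosedPoint F) : Irreducible P.equation :=
  Fact.out

theorem degree_eq_natDegree (P : ClosedPoint F) : P.degree = P.equation.natDegree :=
  finrank_quotient_span_eq_natDegree

instance (P : ClosedPoint F) : FiniteDimensional F P.residueField :=
  P.equation_monic.finite_adjoinRoot

instance [Finite F] (P : ClosedPoint F) : Finite P.residueField :=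
  Module.finite_of_finite F

theorem natCard_residueField [Finite F] (P : ClosedPoint F) :
    Nat.card P.residueField = Nat.card F ^ P.degree :=
  Module.natCard_eq_pow_finrank

/-- The polynomial that cuts out the part of a closed point in the chart `t₁ ≠ 0`. -/
def affineEquation : ClosedPoint F → Polynomial F
  | finite f _ _ => f
  | infinity => 1

/-- The contribution of a closed point at infinity to the degree. -/
def infinityDegree : ClosedPoint F → ℕ
  | finite _ _ _ => 0
  | infinity => 1

theorem affineEquation_monic (P : ClosedPoint F) : P.affineEquation.Monic := by
  cases P with
  | finite f h _ => exact h
  | infinity => exact Polynomial.monic_one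

theorem degree_eq_add (P : ClosedPoint F) :
    P.degree = P.affineEquation.natDegree + P.infinityDegree := by
  rw [degree_eq_natDegree]
  cases P with
  | finite f h _ => rfl
  | infinity => simp [affineEquation, infinityDegree, equation]

theorem isCoprime_affineEquation {P Q : ClosedPoint F} (h : P ≠ Q) :
    IsCoprime P.affineEquation Q.affineEquation := by
  cases P with
  | infinity => exact isCoprime_one_left
  | finite f hf hf' =>
    cases Q with
    | infinity => exact isCoprime_one_right
    | finite g hg hg' =>
      refine (EuclideanDomain.dvd_or_coprime f g hf').resolve_left fun hd => h ?_
      have : f = g := Polynomial.eq_of_monic_of_associated hf hg (hf'.associated_of_dvd hg' hd)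
      subst this
      rfl

theorem aeval_coordinates_finite (f : Polynomial F) (h : f.Monic) (h' : Irreducible f)
    (A : MvPolynomial (Fin 2) F) :
    aeval (finite f h h').coordinates A
      = AdjoinRoot.mk (finite f h h').equation (dehomogenize A) := by
  have : aeval (finite f h h').coordinates
      = (AdjoinRoot.mkₐ (finite f h h').equation).comp (dehomogenize (F := F)) := by
    ext i
    fin_cases i <;> simp [dehomogenize, coordinates]
  rw [this]
  rfl

theorem aeval_coordinates_infinity {n : ℕ} {A : MvPolynomial (Fin 2) F}
    (hA : A.IsHomogeneous n) :
    aeval (infinity : ClosedPoint F).coordinates A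
      = algebraMap F _ ((dehomogenize A).coeff n) := by
  have hr : AdjoinRoot.root (infinity : ClosedPoint F).equation = 0 := by
    have := AdjoinRoot.mk_self (f := (infinity : ClosedPoint F).equation)
    exact this
  conv_lhs => rw [← homogenize_dehomogenize hA, Polynomial.homogenize]
  rw [map_sum, Finset.sum_eq_single (n, 0)]
  · simp [aeval_monomial, coordinates, Finsupp.prod_fintype, Fin.prod_univ_two]
  · rintro ⟨i, j⟩ hij hne
    have hj : j ≠ 0 := by
      rintro rfl
      simp at hij
      exact hne (by simp [hij])
    simp [aeval_monomial, coordinates, Finsupp.prod_fintype, Fin.prod_univ_two, hr, hj]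
  · simp

end ClosedPoint

/-! ### Binary forms -/

section BinaryForm

variable {R : Type u} [CommRing R]

theorem coeff_binaryForm {m : ℕ} (A : Fin (m + 1) → R) (j : Fin (m + 1)) :
    coeff (Finsupp.single 0 (m - (j : ℕ)) + Finsupp.single 1 (j : ℕ)) (binaryForm A) = A j := by
  have h : ∀ i : Fin (m + 1), (C (A i) * X 0 ^ (m - (i : ℕ)) * X 1 ^ (i : ℕ) :
      MvPolynomial (Fin 2) R)
      = monomial (Finsupp.single 0 (m - (i : ℕ)) + Finsupp.single 1 (i : ℕ)) (A i) := by
    intro i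
    rw [X_pow_eq_monomial, X_pow_eq_monomial, C_mul_monomial, monomial_mul, mul_one, mul_one]
  simp only [binaryForm, h]
  rw [coeff_sum, Finset.sum_eq_single j]
  · simp
  · intro i _ hij
    rw [coeff_monomial, if_neg]
    intro he
    have := DFunLike.congr_fun he 1
    simp at this
    exact hij (Fin.ext this)
  · simp

theorem binaryForm_injective {m : ℕ} :
    Function.Injective (binaryForm : (Fin (m + 1) → R) → MvPolynomial (Fin 2) R) := by
  intro A B h
  ext j
  rw [← coeff_binaryForm A j, h, coeff_binaryForm]

/-- The coefficients of the product of a binary quadratic and a binary linear form. -/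
def mulCoeffs (B : Fin 3 → R) (L : Fin 2 → R) : Fin 4 → R :=
  ![B 0 * L 0, B 0 * L 1 + B 1 * L 0, B 1 * L 1 + B 2 * L 0, B 2 * L 1]

theorem binaryForm_mul (B : Fin 3 → R) (L : Fin 2 → R) :
    binaryForm B * binaryForm L = binaryForm (mulCoeffs B L) := by
  simp [binaryForm, mulCoeffs, Fin.sum_univ_succ]
  ring

theorem mulCoeffs_eq_zero [IsDomain R] {B : Fin 3 → R} {L : Fin 2 → R}
    (h : mulCoeffs B L = 0) : B = 0 ∨ L = 0 := by
  rw [or_iff_not_imp_right]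
  intro hL
  have h0 : B 0 * L 0 = 0 := congrFun h 0
  have h1 : B 0 * L 1 + B 1 * L 0 = 0 := congrFun h 1
  have h2 : B 1 * L 1 + B 2 * L 0 = 0 := congrFun h 2
  have h3 : B 2 * L 1 = 0 := congrFun h 3
  by_cases l0 : L 0 = 0
  · have l1 : L 1 ≠ 0 := fun l1 => hL (by ext i; fin_cases i <;> simp [l0, l1])
    have b2 : B 2 = 0 := by simpa [l1] using h3
    have b1 : B 1 = 0 := by simpa [l0, l1] using h2
    have b0 : B 0 = 0 := by simpa [l0, l1] using h1
    ext i; fin_cases i <;> simp [b0, b1, b2]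
  · have b0 : B 0 = 0 := by simpa [l0] using h0
    have b1 : B 1 = 0 := by simpa [l0, b0] using h1
    have b2 : B 2 = 0 := by simpa [l0, b1] using h2
    ext i; fin_cases i <;> simp [b0, b1, b2]

theorem eval_binaryForm_cubic (c : Fin 4 → R) (v : Fin 2 → R) :
    eval v (binaryForm c)
      = c 0 * v 0 ^ 3 + c 1 * v 0 ^ 2 * v 1 + c 2 * v 0 * v 1 ^ 2 + c 3 * v 1 ^ 3 := by
  simp [binaryForm, Fin.sum_univ_succ]
  ring

end BinaryForm

/-! ### Roots of a binary cubic form over a finite field -/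

section Roots

theorem eval_rep_eq_zero_iff {K : Type u} [Field K] (c : Fin 4 → K) (v : Fin 2 → K)
    (hv : v ≠ 0) :
    eval (Projectivization.mk K v hv).rep (binaryForm c) = 0 ↔ eval v (binaryForm c) = 0 := by
  obtain ⟨a, ha⟩ := Projectivization.exists_smul_eq_mk_rep K v hv
  have h : eval (Projectivization.mk K v hv).rep (binaryForm c)
      = (a : K) ^ 3 * eval v (binaryForm c) := by
    rw [← ha, eval_binaryForm_cubic, eval_binaryForm_cubic]
    simp only [Units.smul_def, Pi.smul_apply, smul_eq_mul]
    ring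
  rw [h]
  simp

/-- Coordinates of the points of the projective line: `(1 : y)` and `(0 : 1)`. -/
def pointVector {K : Type u} [Field K] : Option K → Fin 2 → K
  | some y => ![1, y]
  | none => ![0, 1]

theorem pointVector_ne_zero {K : Type u} [Field K] (o : Option K) : pointVector o ≠ 0 := by
  cases o with
  | none => exact fun h => one_ne_zero (congrFun h 1)
  | some y => exact fun h => one_ne_zero (congrFun h 0)

theorem mk_pointVector_bijective {K : Type u} [Field K] :
    Function.Bijective fun o : Option K =>
      Projectivization.mk K (pointVector o) (pointVector_ne_zero o) := by
  constructor
  · intro o o' h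
    obtain ⟨a, ha⟩ := (Projectivization.mk_eq_mk_iff' K _ _ _ _).mp h
    have h0 := congrFun ha 0
    have h1 := congrFun ha 1
    cases o <;> cases o' <;> simp_all [pointVector]
  · intro z
    induction z using Projectivization.ind with
    | h v hv =>
      by_cases h0 : v 0 = 0
      · refine ⟨none, (Projectivization.mk_eq_mk_iff' K _ _ _ _).mpr ⟨(v 1)⁻¹, ?_⟩⟩
        have h1 : v 1 ≠ 0 := fun h1 => hv (by ext i; fin_cases i <;> simp [h0, h1])
        ext i
        fin_cases i <;> simp [pointVector, h0, h1]
      · refine ⟨some (v 1 / v 0), (Projectivization.mk_eq_mk_iff' K _ _ _ _).mpr ⟨(v 0)⁻¹, ?_⟩⟩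
        ext i
        fin_cases i
        · simp [pointVector, h0]
        · simp [pointVector]; field_simp

open Classical in
theorem natCard_roots_eq {K : Type u} [Field K] [Fintype K] (c : Fin 4 → K) :
    Nat.card {z : Projectivization K (Fin 2 → K) // eval z.rep (binaryForm c) = 0}
      = (∑ y : K, if c 0 + c 1 * y + c 2 * y ^ 2 + c 3 * y ^ 3 = 0 then 1 else 0)
        + if c 3 = 0 then 1 else 0 := by
  have e : {o : Option K // eval (pointVector o) (binaryForm c) = 0} ≃
      {z : Projectivization K (Fin 2 → K) // eval z.rep (binaryForm c) = 0} :=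
    (Equiv.ofBijective _ mk_pointVector_bijective).subtypeEquiv
      fun o => (eval_rep_eq_zero_iff c _ (pointVector_ne_zero o)).symm
  have h : Nat.card {o : Option K // eval (pointVector o) (binaryForm c) = 0}
      = ∑ o : Option K, if eval (pointVector o) (binaryForm c) = 0 then 1 else 0 := by
    rw [Nat.card_eq_fintype_card, Fintype.card_subtype, Finset.card_filter]
  rw [← Nat.card_congr e, h, Fintype.sum_option, add_comm]
  simp [eval_binaryForm_cubic, pointVector]

open Classical in
theorem natCard_roots_le {K : Type u} [Field K] [Finite K] {c : Fin 4 → K} (hc : c ≠ 0) :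
    Nat.card {z : Projectivization K (Fin 2 → K) // eval z.rep (binaryForm c) = 0} ≤ 3 := by
  have := Fintype.ofFinite K
  rw [natCard_roots_eq, ← Finset.card_filter]
  let p : Polynomial K := Polynomial.C (c 3) * Polynomial.X ^ 3 + Polynomial.C (c 2) *
    Polynomial.X ^ 2 + Polynomial.C (c 1) * Polynomial.X + Polynomial.C (c 0)
  have hp : p ≠ 0 := by
    intro hp
    apply hc
    have h3 : p.coeff 3 = c 3 := by simp [p]
    have h2 : p.coeff 2 = c 2 := by simp [p]
    have h1 : p.coeff 1 = c 1 := by simp [p, Polynomial.coeff_X_pow]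
    have h0 : p.coeff 0 = c 0 := by simp [p]
    rw [hp] at h0 h1 h2 h3
    ext i
    fin_cases i <;> simp_all
  have hroots : (Finset.univ.filter fun y : K =>
      c 0 + c 1 * y + c 2 * y ^ 2 + c 3 * y ^ 3 = 0).card ≤ p.natDegree := by
    refine (Finset.card_le_card (t := p.roots.toFinset) fun y hy => ?_).trans
      ((Multiset.toFinset_card_le _).trans (Polynomial.card_roots' p))
    simp only [Finset.mem_filter, Finset.mem_univ, true_and] at hy
    rw [Multiset.mem_toFinset, Polynomial.mem_roots hp, Polynomial.IsRoot]
    simp only [p, Polynomial.eval_add, Polynomial.eval_mul, Polynomial.eval_C,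
      Polynomial.eval_pow, Polynomial.eval_X]
    linear_combination hy
  split_ifs with h3
  · have : p.natDegree ≤ 2 := by
      simp only [p, h3, map_zero, zero_mul, zero_add]
      exact Polynomial.natDegree_quadratic_le
    omega
  · have : p.natDegree ≤ 3 := Polynomial.natDegree_cubic_le
    omega

theorem natCard_roots_zero {K : Type u} [Field K] [Finite K] :
    Nat.card {z : Projectivization K (Fin 2 → K) // eval z.rep (binaryForm (0 : Fin 4 → K)) = 0}
      = Nat.card K + 1 := by
  have := Fintype.ofFinite K
  rw [natCard_roots_eq]
  simp

/-- Indices for the points of the cone over the twisted cubic. -/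
abbrev ConeIndex (K : Type u) [Field K] : Type u := (K × {a : K // a ≠ 0}) ⊕ K

/-- The points of the cone over the twisted cubic. -/
def conePoint {K : Type u} [Field K] : ConeIndex K → Fin 4 → K
  | Sum.inl (y, a) => ![a, a * y, a * y ^ 2, a * y ^ 3]
  | Sum.inr a => ![0, 0, 0, a]

theorem conePoint_injective {K : Type u} [Field K] :
    Function.Injective (conePoint : ConeIndex K → Fin 4 → K) := by
  rintro (⟨y, a, ha⟩ | a) (⟨y', a', ha'⟩ | a') h
  · have h0 : a = a' := congrFun h 0
    have h1 : a * y = a' * y' := congrFun h 1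
    subst h0
    have := mul_left_cancel₀ ha h1
    subst this
    rfl
  · exact absurd (congrFun h 0) ha
  · exact absurd (congrFun h 0).symm ha'
  · have h3 : a = a' := congrFun h 3
    rw [h3]

/-- The equations of the cone over the twisted cubic. -/
def IsConePoint {R : Type u} [CommRing R] (w : Fin 4 → R) : Prop :=
  w 0 * w 2 = w 1 * w 1 ∧ w 1 * w 3 = w 2 * w 2 ∧ w 0 * w 3 = w 1 * w 2

theorem isConePoint_conePoint {K : Type u} [Field K] (j : ConeIndex K) :
    IsConePoint (conePoint j) := by
  rcases j with ⟨y, a, ha⟩ | a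
  · refine ⟨?_, ?_, ?_⟩ <;> simp [conePoint] <;> ring
  · refine ⟨?_, ?_, ?_⟩ <;> simp [conePoint]

/-- The adjusted number of roots of a binary cubic form is, up to scaling, the Fourier transform of
the cone over the twisted cubic. -/
theorem sum_addChar_conePoint {K : Type u} [Field K] [Fintype K] {χ : AddChar K ℂ}
    (hχ : χ.IsPrimitive) (c : Fin 4 → K) [inst : Fintype (ConeIndex K)] :
    ∑ j : ConeIndex K, χ (∑ i, conePoint j i * c i)
      = (Nat.card K : ℂ) * ((Nat.card {z : Projectivization K (Fin 2 → K) //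
          eval z.rep (binaryForm c) = 0} : ℂ) - 1) := by
  classical
  obtain rfl := Subsingleton.elim inst (instFintypeSum _ _)
  -- Each line of the cone with `a ≠ 0` contributes `|K|·[root] - 1`. The origin is included only in
  -- the line of `(0, 0, 0, a)`, so the `|K|` other lines together produce the `-1` in `r - 1`.
  have key : ∀ b : K, ∑ a : {a : K // a ≠ 0}, χ (a * b)
      = (if b = 0 then (Fintype.card K : ℂ) else 0) - 1 := by
    intro b
    have h := AddChar.sum_mulShift b hχ
    rw [← Finset.sum_erase_add _ _ (Finset.mem_univ (0 : K)), zero_mul,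
      AddChar.map_zero_eq_one] at h
    have h2 : ∑ a : {a : K // a ≠ 0}, χ (a * b) = ∑ a ∈ Finset.univ.erase 0, χ (a * b) := by
      rw [← Finset.sum_subtype (Finset.univ.erase 0) (p := fun a : K => a ≠ 0)
        (by simp) (fun a => χ (a * b))]
    rw [h2, eq_sub_iff_add_eq, h]
    split_ifs <;> simp
  rw [natCard_roots_eq]
  have h1 : ∀ (y : K) (a : {a : K // a ≠ 0}),
      ∑ i, conePoint (Sum.inl (y, a)) i * c i
        = a * (c 0 + c 1 * y + c 2 * y ^ 2 + c 3 * y ^ 3) := by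
    intro y a
    simp [conePoint, Fin.sum_univ_succ]
    ring
  have h2 : ∀ a : K, ∑ i, conePoint (Sum.inr a) i * c i = a * c 3 := by
    intro a
    simp [conePoint, Fin.sum_univ_succ]
  have h3 : ∑ j : ConeIndex K, χ (∑ i, conePoint j i * c i)
      = (∑ y : K, ∑ a : {a : K // a ≠ 0}, χ (∑ i, conePoint (Sum.inl (y, a)) i * c i))
        + ∑ a : K, χ (∑ i, conePoint (Sum.inr a) i * c i) := by
    rw [Fintype.sum_sum_type, Fintype.sum_prod_type]
  rw [h3]
  simp only [h1, h2, key, AddChar.sum_mulShift _ hχ]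
  simp only [Finset.sum_sub_distrib, Finset.sum_const, Finset.card_univ, Nat.card_eq_fintype_card]
  push_cast
  rw [mul_sub, mul_add, Finset.mul_sum]
  simp only [mul_ite, mul_one, mul_zero, nsmul_eq_mul]
  ring

end Roots

/-! ### Residues -/

namespace ClosedPoint

variable {F : Type u} [Field F]

/-- The linear functional on `κ(P) = F[T] / (p)` that takes the coefficient of `T ^ (deg p - 1)`. -/
def residue (P : ClosedPoint F) : P.residueField →ₗ[F] F :=
  Polynomial.lcoeff F (P.equation.natDegree - 1) ∘ₗ AdjoinRoot.modByMonicHom P.equation_monic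

theorem residue_mk (P : ClosedPoint F) (a : Polynomial F) :
    P.residue (AdjoinRoot.mk P.equation a)
      = (a %ₘ P.equation).coeff (P.equation.natDegree - 1) :=
  rfl

theorem residue_ne_zero (P : ClosedPoint F) : P.residue ≠ 0 := by
  intro h
  have h1 : P.residue (AdjoinRoot.mk P.equation (Polynomial.X ^ (P.equation.natDegree - 1))) = 0 := by
    rw [h, LinearMap.zero_apply]
  have hpos := P.equation_irreducible.natDegree_pos
  rw [residue_mk, (Polynomial.modByMonic_eq_self_iff P.equation_monic).mpr] at h1
  · simp at h1
  · rw [Polynomial.degree_X_pow, Polynomial.degree_eq_natDegree P.equation_monic.ne_zero]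
    exact_mod_cast Nat.sub_lt hpos one_pos

/-- The residue field at infinity is `F` itself. This recovers the component at infinity, which
interpolation in the affine chart does not see. -/
theorem residue_infinity_injective :
    Function.Injective (infinity : ClosedPoint F).residue := by
  have h1 : Module.finrank F (infinity : ClosedPoint F).residueField = 1 := by
    have := (infinity : ClosedPoint F).degree_eq_natDegree
    rw [degree] at this
    rw [this, equation, Polynomial.natDegree_X]
  have hs : Function.Surjective (infinity : ClosedPoint F).residue :=
    LinearMap.surjective (residue_ne_zero _)
  exact (LinearMap.injective_iff_surjective_of_finrank_eq_finrank (by simp [h1])).mpr hs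

/-- The additive character of `κ(P)` induced by an additive character of `F` and the residue. -/
def residueChar (P : ClosedPoint F) (ψ : AddChar F ℂ) : AddChar P.residueField ℂ :=
  ψ.compAddMonoidHom P.residue.toAddMonoidHom

theorem residueChar_apply (P : ClosedPoint F) (ψ : AddChar F ℂ) (x : P.residueField) :
    P.residueChar ψ x = ψ (P.residue x) :=
  rfl

theorem residueChar_isPrimitive (P : ClosedPoint F) {ψ : AddChar F ℂ} (hψ : ψ ≠ 1) :
    (P.residueChar ψ).IsPrimitive := by
  refine AddChar.IsPrimitive.of_ne_one ?_
  obtain ⟨a, ha⟩ := AddChar.ne_one_iff.mp hψ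
  obtain ⟨x, hx⟩ := LinearMap.surjective P.residue_ne_zero a
  exact AddChar.ne_one_iff.mpr ⟨x, by rwa [residueChar_apply, hx]⟩

theorem affineEquation_of_ne_infinity {P : ClosedPoint F} (hP : P ≠ infinity) :
    P.affineEquation = P.equation := by
  cases P with
  | finite f h h' => rfl
  | infinity => exact absurd rfl hP

/-- The polynomial of least degree with a given residue class at a point of the chart `t₁ ≠ 0`
(zero at infinity). -/
def affineLift (P : ClosedPoint F) : P.residueField →ₗ[F] Polynomial F :=
  Polynomial.modByMonicHom P.affineEquation ∘ₗ AdjoinRoot.modByMonicHom P.equation_monic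

theorem affineLift_apply (P : ClosedPoint F) (x : P.residueField) :
    P.affineLift x = AdjoinRoot.modByMonicHom P.equation_monic x %ₘ P.affineEquation :=
  rfl

theorem affineLift_infinity (x : (infinity : ClosedPoint F).residueField) :
    (infinity : ClosedPoint F).affineLift x = 0 := by
  rw [affineLift_apply, affineEquation, Polynomial.modByMonic_one]

theorem degree_affineLift_lt (P : ClosedPoint F) (x : P.residueField) :
    (P.affineLift x).degree < P.affineEquation.degree :=
  Polynomial.degree_modByMonic_lt _ P.affineEquation_monic

theorem mk_affineLift {P : ClosedPoint F} (hP : P ≠ infinity) (x : P.residueField) :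
    AdjoinRoot.mk P.equation (P.affineLift x) = x := by
  conv_rhs => rw [← AdjoinRoot.mk_leftInverse P.equation_monic x]
  rw [affineLift_apply, AdjoinRoot.mk_eq_mk, affineEquation_of_ne_infinity hP,
    Polynomial.modByMonic_eq_sub_mul_div, sub_sub_cancel_left, dvd_neg]
  exact dvd_mul_right _ _

end ClosedPoint

/-! ### Interpolation -/

/-- Lets the remainder modulo the full modulus be computed one partial fraction at a time. -/
theorem mul_modByMonic_mul {F : Type u} [Field F] {p c : Polynomial F} (hp : p.Monic)
    (hc : c.Monic) (x : Polynomial F) : (x * c) %ₘ (p * c) = (x %ₘ p) * c := by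
  refine (Polynomial.div_modByMonic_unique (x /ₘ p) _ (hp.mul hc) ⟨?_, ?_⟩).2
  · conv_rhs => rw [← Polynomial.modByMonic_add_div x p]
    ring
  · rw [Polynomial.degree_mul, Polynomial.degree_mul]
    have hc0 : c.degree ≠ ⊥ := Polynomial.degree_ne_bot.mpr hc.ne_zero
    exact WithBot.add_lt_add_right hc0 (Polynomial.degree_modByMonic_lt _ hp)

section Interpolation

open ClosedPoint

variable {F : Type u} [Field F]

/-- The polynomial that cuts out the part of a divisor in the chart `t₁ ≠ 0`. -/
def affineModulus (D : Finset (ClosedPoint F)) : Polynomial F :=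
  ∏ P ∈ D, P.affineEquation

open Classical in
/-- The product of the affine equations of the other points of a divisor. -/
def cofactor (D : Finset (ClosedPoint F)) (P : ClosedPoint F) : Polynomial F :=
  ∏ Q ∈ D.erase P, Q.affineEquation

theorem affineModulus_monic (D : Finset (ClosedPoint F)) : (affineModulus D).Monic :=
  Polynomial.monic_prod_of_monic _ _ fun P _ => P.affineEquation_monic

theorem cofactor_monic (D : Finset (ClosedPoint F)) (P : ClosedPoint F) : (cofactor D P).Monic :=
  Polynomial.monic_prod_of_monic _ _ fun P _ => P.affineEquation_monic

theorem affineEquation_mul_cofactor {D : Finset (ClosedPoint F)} {P : ClosedPoint F}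
    (hP : P ∈ D) : P.affineEquation * cofactor D P = affineModulus D := by
  classical
  exact Finset.mul_prod_erase D affineEquation hP

theorem natDegree_affineModulus (D : Finset (ClosedPoint F)) :
    (affineModulus D).natDegree + ∑ P ∈ D, P.infinityDegree = divisorDegree D := by
  rw [affineModulus, Polynomial.natDegree_prod_of_monic _ _ fun P _ => P.affineEquation_monic,
    ← Finset.sum_add_distrib]
  exact Finset.sum_congr rfl fun P _ => P.degree_eq_add.symm

/-- The polynomial `∑ x_P ∏_{Q ≠ P} f_Q`, for residues `x_P` at the points of `D`. -/
def interpolate (D : Finset (ClosedPoint F)) :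
    (∀ P : D, P.1.residueField) →ₗ[F] Polynomial F :=
  ∑ P : D, LinearMap.mulRight F (cofactor D P.1) ∘ₗ P.1.affineLift ∘ₗ LinearMap.proj P

theorem interpolate_apply (D : Finset (ClosedPoint F)) (x : ∀ P : D, P.1.residueField) :
    interpolate D x = ∑ P : D, P.1.affineLift (x P) * cofactor D P.1 := by
  simp [interpolate, LinearMap.sum_apply]

theorem degree_interpolate_lt (D : Finset (ClosedPoint F)) (x : ∀ P : D, P.1.residueField) :
    (interpolate D x).degree < (affineModulus D).degree := by
  rw [interpolate_apply]
  refine (Polynomial.degree_sum_le _ _).trans_lt ((Finset.sup_lt_iff ?_).mpr fun P _ => ?_)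
  · exact bot_lt_iff_ne_bot.mpr (Polynomial.degree_ne_bot.mpr (affineModulus_monic D).ne_zero)
  · rw [← affineEquation_mul_cofactor P.2, Polynomial.degree_mul, Polynomial.degree_mul]
    exact WithBot.add_lt_add_right (Polynomial.degree_ne_bot.mpr (cofactor_monic D P.1).ne_zero)
      (P.1.degree_affineLift_lt _)

theorem affineEquation_dvd_cofactor {D : Finset (ClosedPoint F)} {P Q : ClosedPoint F}
    (hP : P ∈ D) (h : P ≠ Q) : P.affineEquation ∣ cofactor D Q := by
  classical
  exact Finset.dvd_prod_of_mem affineEquation (Finset.mem_erase.mpr ⟨h, hP⟩)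

theorem mk_cofactor_ne_zero (D : Finset (ClosedPoint F)) (P : ClosedPoint F)
    (hP : P ≠ infinity) : AdjoinRoot.mk P.equation (cofactor D P) ≠ 0 := by
  classical
  rw [Ne, AdjoinRoot.mk_eq_zero]
  intro h
  have hc : IsCoprime P.affineEquation (cofactor D P) :=
    IsCoprime.prod_right fun Q hQ => isCoprime_affineEquation (Finset.ne_of_mem_erase hQ).symm
  rw [affineEquation_of_ne_infinity hP] at hc
  exact P.equation_irreducible.not_isUnit (hc.isUnit_of_dvd' dvd_rfl h)

theorem mk_interpolate {D : Finset (ClosedPoint F)} (x : ∀ P : D, P.1.residueField) (P : D)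
    (hP : P.1 ≠ infinity) :
    AdjoinRoot.mk P.1.equation (interpolate D x)
      = x P * AdjoinRoot.mk P.1.equation (cofactor D P.1) := by
  rw [interpolate_apply, map_sum, Finset.sum_eq_single P]
  · rw [map_mul, mk_affineLift hP]
  · intro Q _ hQ
    rw [map_mul]
    have h : AdjoinRoot.mk P.1.equation (cofactor D Q.1) = 0 := by
      rw [AdjoinRoot.mk_eq_zero, ← affineEquation_of_ne_infinity hP]
      exact affineEquation_dvd_cofactor P.2 fun h => hQ (Subtype.ext h.symm)
    rw [h, mul_zero]
  · simp

theorem affineModulus_dvd {D : Finset (ClosedPoint F)} {a : Polynomial F}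
    (h : ∀ P ∈ D, P ≠ infinity → AdjoinRoot.mk P.equation a = 0) : affineModulus D ∣ a := by
  refine Finset.prod_dvd_of_coprime (fun P _ Q _ hPQ => isCoprime_affineEquation hPQ)
    fun P hP => ?_
  by_cases hi : P = infinity
  · subst hi
    exact one_dvd _
  · rw [affineEquation_of_ne_infinity hi, ← AdjoinRoot.mk_eq_zero]
    exact h P hP hi

/-- The residue theorem for one partial fraction: the cofactor is monic, so multiplying by it only
shifts the coefficient that defines the residue. At infinity both sides vanish, because `j < n`
makes the monomial divisible by `t₁`. -/
theorem coeff_interpolate_term {D : Finset (ClosedPoint F)} {P : ClosedPoint F} (hP : P ∈ D)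
    (x : P.residueField) {j n : ℕ} (hj : j < n) :
    (((P.affineLift x * Polynomial.X ^ j) %ₘ P.affineEquation) * cofactor D P).coeff
        ((affineModulus D).natDegree - 1)
      = P.residue (x * aeval P.coordinates (X 0 ^ j * X 1 ^ (n - j) : MvPolynomial (Fin 2) F)) := by
  by_cases hi : P = infinity
  · subst hi
    rw [affineLift_infinity, aeval_coordinates_infinity (n := n)]
    · have : n ≠ j := hj.ne'
      simp [dehomogenize, Polynomial.coeff_X_pow, this]
    · have := (isHomogeneous_X_pow (R := F) (0 : Fin 2) j).mul (isHomogeneous_X_pow 1 (n - j))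
      rwa [Nat.add_sub_cancel' hj.le] at this
  · have hpos := P.equation_irreducible.natDegree_pos
    have hdeg : (affineModulus D).natDegree - 1
        = (P.equation.natDegree - 1) + (cofactor D P).natDegree := by
      rw [← affineEquation_mul_cofactor hP, P.affineEquation_monic.natDegree_mul
        (cofactor_monic D P), affineEquation_of_ne_infinity hi]
      omega
    have hval : aeval P.coordinates (X 0 ^ j * X 1 ^ (n - j) : MvPolynomial (Fin 2) F)
        = AdjoinRoot.mk P.equation (Polynomial.X ^ j) := by
      cases P with
      | infinity => exact absurd rfl hi
      | finite f h h' =>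
        rw [aeval_coordinates_finite]
        simp [dehomogenize]
    conv_rhs => rw [hval, ← mk_affineLift hi x, ← map_mul, residue_mk]
    rw [hdeg, affineEquation_of_ne_infinity hi, Polynomial.coeff_mul_add_eq_of_natDegree_le _ le_rfl,
      (cofactor_monic D P).coeff_natDegree, mul_one]
    have := Polynomial.natDegree_modByMonic_lt (P.affineLift x * Polynomial.X ^ j)
      P.equation_monic (fun h => P.equation_irreducible.not_isUnit (by rw [h]; exact isUnit_one))
    omega

/-- If residues at `D` are orthogonal to the forms of degree `n` that vanish at infinity, then the
interpolating polynomial has small degree. -/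
theorem natDegree_interpolate_add_lt {D : Finset (ClosedPoint F)}
    {x : ∀ P : D, P.1.residueField} {n : ℕ}
    (h : ∀ j < n, ∑ P : D, P.1.residue
      (x P * aeval P.1.coordinates (X 0 ^ j * X 1 ^ (n - j) : MvPolynomial (Fin 2) F)) = 0)
    (h0 : interpolate D x ≠ 0) :
    (interpolate D x).natDegree + n < (affineModulus D).natDegree := by
  have hlt := Polynomial.natDegree_lt_natDegree h0 (degree_interpolate_lt D x)
  by_contra! hn
  -- This shift moves the leading term to degree `deg M - 1`, `M` being the modulus, where
  -- orthogonality forces the coefficient to be zero. No reduction modulo `M` takes place, and `hn`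
  -- gives `j < n`.
  obtain ⟨j, hj⟩ : ∃ j, (affineModulus D).natDegree - 1 = (interpolate D x).natDegree + j :=
    ⟨_, (Nat.add_sub_cancel' (by omega)).symm⟩
  have hself : (interpolate D x * Polynomial.X ^ j) %ₘ affineModulus D
      = interpolate D x * Polynomial.X ^ j := by
    rw [Polynomial.modByMonic_eq_self_iff (affineModulus_monic D)]
    refine Polynomial.degree_lt_degree ?_
    rw [Polynomial.natDegree_mul_X_pow j h0]
    omega
  have hcoeff : (interpolate D x * Polynomial.X ^ j).coeff ((affineModulus D).natDegree - 1) = 0 := by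
    rw [← hself, interpolate_apply, Finset.sum_mul, ← Polynomial.modByMonicHom_apply, map_sum,
      Polynomial.finsetSum_coeff, ← h j (by omega)]
    refine Finset.sum_congr rfl fun P _ => ?_
    rw [← coeff_interpolate_term P.2 (x P) (by omega : j < n), Polynomial.modByMonicHom_apply,
      ← mul_modByMonic_mul P.1.affineEquation_monic (cofactor_monic D P.1),
      affineEquation_mul_cofactor P.2, mul_right_comm]
  rw [hj, Polynomial.coeff_mul_X_pow, Polynomial.coeff_natDegree,
    Polynomial.leadingCoeff_eq_zero] at hcoeff
  exact h0 hcoeff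

/-- Reduction modulo each finite point kills the finite components, cofactors being units there.
Only infinity is left in the relation for `t₀ ^ n`, a form that takes the value 1 there. -/
theorem eq_zero_of_interpolate_eq_zero {D : Finset (ClosedPoint F)}
    {x : ∀ P : D, P.1.residueField} (h0 : interpolate D x = 0) {n : ℕ}
    (h : ∑ P : D, P.1.residue
      (x P * aeval P.1.coordinates (X 0 ^ n : MvPolynomial (Fin 2) F)) = 0) : x = 0 := by
  have hfin : ∀ P : D, P.1 ≠ infinity → x P = 0 := by
    intro P hP
    have := mk_interpolate x P hP
    rw [h0, map_zero] at this
    exact (mul_eq_zero.mp this.symm).resolve_right (mk_cofactor_ne_zero D P.1 hP)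
  funext P
  by_cases hP : P.1 = infinity
  · rw [Finset.sum_eq_single P] at h
    · obtain ⟨P, hPD⟩ := P
      subst hP
      have h1 : aeval (infinity : ClosedPoint F).coordinates (X 0 ^ n : MvPolynomial (Fin 2) F)
          = 1 := by simp [coordinates]
      simp only [h1, mul_one] at h
      exact residue_infinity_injective (h.trans (map_zero _).symm)
    · intro Q _ hQ
      rw [hfin Q fun hQi => hQ (Subtype.ext (hQi.trans hP.symm)), zero_mul, map_zero]
    · simp
  · exact hfin P hP

end Interpolation

/-! ### Counting polynomial points on the cone over the twisted cubic -/

theorem sum_pow_sub_le {q : ℕ} (hq : 2 ≤ q) {n N : ℕ} (hn : n ≤ N + 1) :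
    ∑ e ∈ Finset.range n, q ^ (N - e) ≤ 2 * q ^ N := by
  -- The extra summand, equal to the last term of the sum, makes the induction close. The case `r =
  -- 0` is set apart because `q ^ (N + 1) ≤ 2 * q ^ N` fails for `q > 2`.
  have h : ∀ r, r ≤ N + 1 → ∑ e ∈ Finset.range r, q ^ (N - e) + q ^ (N + 1 - r) ≤ 2 * q ^ N
      ∨ r = 0 := by
    intro r
    induction r with
    | zero => simp
    | succ r ih =>
      intro hr
      left
      rw [Finset.sum_range_succ]
      have e1 : N + 1 - (r + 1) = N - r := by omega
      rw [e1]
      rcases ih (by omega) with h | rfl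
      · have e2 : N + 1 - r = (N - r) + 1 := by omega
        rw [e2, pow_succ] at h
        nlinarith [Nat.zero_le (q ^ (N - r))]
      · simp
        omega
  rcases h n hn with h | rfl
  · omega
  · simp

section Cone

variable {F : Type u} [Field F]

theorem mem_degreeLT_of_natDegree_lt {a : Polynomial F} {n : ℕ} (h : a.natDegree < n) :
    a ∈ Polynomial.degreeLT F n :=
  Polynomial.mem_degreeLT.mpr (Polynomial.degree_le_natDegree.trans_lt (by exact_mod_cast h))

/-- Write `(a 0, a 1) = d (u, v)` with `u`, `v` coprime. The equations become `u a₂ = d v²` and then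
`u a₃ = (d / u) v³`, so coprimality gives `u² ∣ d`, with quotient `g`. -/
theorem IsConePoint.exists_eq {a : Fin 4 → Polynomial F} (h : IsConePoint a) (h0 : a 0 ≠ 0) :
    ∃ g u v : Polynomial F, a = ![g * u ^ 3, g * u ^ 2 * v, g * u * v ^ 2, g * v ^ 3] := by
  classical
  obtain ⟨h1, -, h3⟩ := h
  have hg0 : EuclideanDomain.gcd (a 0) (a 1) ≠ 0 := fun hg =>
    h0 (EuclideanDomain.gcd_eq_zero_iff.mp hg).1
  obtain ⟨u, hu⟩ := EuclideanDomain.gcd_dvd_left (a 0) (a 1)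
  obtain ⟨v, hv⟩ := EuclideanDomain.gcd_dvd_right (a 0) (a 1)
  set d := EuclideanDomain.gcd (a 0) (a 1) with hd
  have hcop : IsCoprime u v := by
    obtain ⟨x, y, hxy⟩ : ∃ x y, d = a 0 * x + a 1 * y :=
      ⟨_, _, EuclideanDomain.gcd_eq_gcd_ab (a 0) (a 1)⟩
    refine ⟨x, y, mul_left_cancel₀ hg0 ?_⟩
    linear_combination -hxy - x * hu - y * hv
  have hu0 : u ≠ 0 := by
    rintro rfl
    exact h0 (by rw [hu, mul_zero])
  have e1 : u * a 2 = d * v ^ 2 := by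
    refine mul_left_cancel₀ hg0 ?_
    linear_combination h1 - a 2 * hu + (a 1 + d * v) * hv
  obtain ⟨b, hb⟩ : u ∣ d := (hcop.pow_right (n := 2)).dvd_of_dvd_mul_right ⟨_, e1.symm⟩
  have e2 : a 2 = b * v ^ 2 := by
    refine mul_left_cancel₀ hu0 ?_
    rw [e1]
    linear_combination v ^ 2 * hb
  have e3 : u * a 3 = b * v ^ 3 := by
    refine mul_left_cancel₀ hg0 ?_
    linear_combination h3 - a 3 * hu + a 2 * hv + d * v * e2
  obtain ⟨g, hg⟩ : u ∣ b := (hcop.pow_right (n := 3)).dvd_of_dvd_mul_right ⟨_, e3.symm⟩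
  have e4 : a 3 = g * v ^ 3 := by
    refine mul_left_cancel₀ hu0 ?_
    rw [e3]
    linear_combination v ^ 3 * hg
  refine ⟨g, u, v, ?_⟩
  ext1 i
  fin_cases i
  · change a 0 = g * u ^ 3
    rw [hu, hb, hg]; ring
  · change a 1 = g * u ^ 2 * v
    rw [hv, hb, hg]; ring
  · change a 2 = g * u * v ^ 2
    rw [e2, hg]; ring
  · exact e4

/-- The nonzero points of the cone over the twisted cubic whose coordinates are polynomials of
degree less than `m - ℓ + i k`. -/
def conePolynomials (F : Type u) [Field F] (m ℓ k : ℕ) : Set (Fin 4 → Polynomial F) :=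
  {a | a ≠ 0 ∧ IsConePoint a ∧ ∀ i, a i ≠ 0 → (a i).natDegree + ℓ < m + (i : ℕ) * k}

/-- The points `(0, 0, 0, g)` of the cone. -/
def coneVertexLine (r : ℕ) (g : Polynomial.degreeLT F r) : Fin 4 → Polynomial F :=
  ![0, 0, 0, g]

/-- The points `(g u³, g u² v, g u v², g v³)` of the cone. -/
def coneParametrization (r s t : ℕ) (x : Polynomial.degreeLT F r × Polynomial.degreeLT F s ×
    Polynomial.degreeLT F t) : Fin 4 → Polynomial F :=
  ![x.1 * x.2.1 ^ 3, x.1 * x.2.1 ^ 2 * x.2.2, x.1 * x.2.1 * x.2.2 ^ 2, x.1 * x.2.2 ^ 3]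

theorem conePolynomials_subset {m ℓ k : ℕ} (hk : 3 * k ≤ ℓ) :
    conePolynomials F m ℓ k ⊆
      {a | ℓ - 3 * k < m ∧ a ∈ Set.range (coneVertexLine (F := F) (m - (ℓ - 3 * k)))} ∪
      ⋃ e ∈ {e | 3 * e + ℓ < m},
        Set.range (coneParametrization (F := F) (m - ℓ - 3 * e) (e + 1) (e + k + 1)) := by
  rintro a ⟨hne, hcone, hdeg⟩
  by_cases h0 : a 0 = 0
  · left
    obtain ⟨h1, h2, -⟩ := hcone
    have a1 : a 1 = 0 := by
      rw [h0, zero_mul] at h1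
      exact mul_self_eq_zero.mp h1.symm
    have a2 : a 2 = 0 := by
      rw [a1, zero_mul] at h2
      exact mul_self_eq_zero.mp h2.symm
    have a3 : a 3 ≠ 0 := by
      intro a3
      apply hne
      ext1 i
      fin_cases i <;> simp [h0, a1, a2, a3]
    have hd : (a 3).natDegree + ℓ < m + 3 * k := hdeg 3 a3
    refine ⟨by omega, ⟨a 3, mem_degreeLT_of_natDegree_lt (by omega)⟩, ?_⟩
    ext1 i
    fin_cases i <;> simp [coneVertexLine, h0, a1, a2]
  · right
    obtain ⟨g, u, v, rfl⟩ := hcone.exists_eq h0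
    change g * u ^ 3 ≠ 0 at h0
    have hg : g ≠ 0 := left_ne_zero_of_mul h0
    have hu : u ≠ 0 := fun h => h0 (by rw [h]; ring)
    have hd0 : g.natDegree + 3 * u.natDegree + ℓ < m := by
      have := hdeg 0 h0
      simpa [Polynomial.natDegree_mul hg (pow_ne_zero 3 hu)] using this
    have hd3 : v.natDegree = 0 ∨ g.natDegree + 3 * v.natDegree + ℓ < m + 3 * k := by
      by_cases hv : v = 0
      · simp [hv]
      · right
        have := hdeg 3 (mul_ne_zero hg (pow_ne_zero 3 hv))
        simpa [Polynomial.natDegree_mul hg (pow_ne_zero 3 hv)] using this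
    simp only [Set.mem_iUnion]
    -- The largest degree of `u` allowed by the first coordinate once `deg g` is known; the last
    -- coordinate then allows `v` exactly `k` more.
    refine ⟨(m - 1 - ℓ - g.natDegree) / 3, ?_, ?_⟩
    · simp only [Set.mem_ofPred_eq]
      omega
    · exact ⟨⟨⟨g, mem_degreeLT_of_natDegree_lt (by omega)⟩,
        ⟨u, mem_degreeLT_of_natDegree_lt (by omega)⟩,
        ⟨v, mem_degreeLT_of_natDegree_lt (by omega)⟩⟩, rfl⟩

theorem ncard_range_le {α β : Type*} [Finite α] (f : α → β) :
    (Set.range f).ncard ≤ Nat.card α := by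
  rw [← Set.image_univ, ← Set.ncard_univ]
  exact Set.ncard_image_le Set.finite_univ

theorem finite_conePolynomials [Finite F] {m ℓ k : ℕ} (hk : 3 * k ≤ ℓ) :
    (conePolynomials F m ℓ k).Finite := by
  refine Set.Finite.subset (Set.Finite.union ?_ ?_) (conePolynomials_subset hk)
  · exact (Set.finite_range _).subset fun a ha => ha.2
  · exact Set.Finite.biUnion ((Set.finite_lt_nat m).subset fun e he => by
      simp only [Set.mem_ofPred_eq] at he ⊢; omega) fun e _ => Set.finite_range _

theorem ncard_conePolynomials_le [Finite F] {m ℓ k : ℕ} (hk : 3 * k ≤ ℓ) :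
    (conePolynomials F m ℓ k).ncard * Nat.card F ^ (ℓ - 3 * k) ≤ 3 * Nat.card F ^ (m + 2) := by
  classical
  set q := Nat.card F with hqdef
  have hq : 2 ≤ q := Finite.one_lt_card
  let S : Finset ℕ := (Finset.range m).filter fun e => 3 * e + ℓ < m
  have hS : (⋃ e ∈ {e | 3 * e + ℓ < m},
        Set.range (coneParametrization (F := F) (m - ℓ - 3 * e) (e + 1) (e + k + 1)))
      = ⋃ e ∈ S,
        Set.range (coneParametrization (F := F) (m - ℓ - 3 * e) (e + 1) (e + k + 1)) := by
    ext a
    simp only [Set.mem_iUnion, Set.mem_ofPred_eq, S, Finset.mem_filter, Finset.mem_range]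
    constructor
    · rintro ⟨e, he, h⟩
      exact ⟨e, ⟨by omega, he⟩, h⟩
    · rintro ⟨e, he, h⟩
      exact ⟨e, he.2, h⟩
  have h1 : {a | ℓ - 3 * k < m ∧
      a ∈ Set.range (coneVertexLine (F := F) (m - (ℓ - 3 * k)))}.ncard * q ^ (ℓ - 3 * k)
      ≤ q ^ m := by
    by_cases hm : ℓ - 3 * k < m
    · have h := ncard_range_le (coneVertexLine (F := F) (m - (ℓ - 3 * k)))
      rw [natCard_degreeLT, ← hqdef] at h
      simp only [hm, true_and, Set.ofPred_mem_eq]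
      calc _ ≤ q ^ (m - (ℓ - 3 * k)) * q ^ (ℓ - 3 * k) := Nat.mul_le_mul_right _ h
        _ = q ^ m := by rw [← pow_add, Nat.sub_add_cancel hm.le]
    · simp [hm]
  have h2 : (⋃ e ∈ S,
      Set.range (coneParametrization (F := F) (m - ℓ - 3 * e) (e + 1) (e + k + 1))).ncard
        * q ^ (ℓ - 3 * k) ≤ 2 * q ^ (m + 2) := by
    calc _ ≤ (∑ e ∈ S, q ^ (m - ℓ - 3 * e) * (q ^ (e + 1) * q ^ (e + k + 1)))
          * q ^ (ℓ - 3 * k) := by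
          refine Nat.mul_le_mul_right _ ((Finset.set_ncard_biUnion_le S _).trans
            (Finset.sum_le_sum fun e _ => (ncard_range_le _).trans_eq ?_))
          rw [Nat.card_prod, Nat.card_prod, natCard_degreeLT, natCard_degreeLT, natCard_degreeLT]
      _ = ∑ e ∈ S, q ^ (m + 2 - 2 * k - e) := by
          rw [Finset.sum_mul]
          refine Finset.sum_congr rfl fun e he => ?_
          simp only [S, Finset.mem_filter, Finset.mem_range] at he
          rw [← pow_add, ← pow_add, ← pow_add]
          congr 1
          omega
      _ ≤ ∑ e ∈ S, q ^ (m + 2 - e) :=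
          Finset.sum_le_sum fun e _ => Nat.pow_le_pow_right (by omega) (by omega)
      _ ≤ ∑ e ∈ Finset.range m, q ^ (m + 2 - e) :=
          Finset.sum_le_sum_of_subset (Finset.filter_subset _ _)
      _ ≤ 2 * q ^ (m + 2) := sum_pow_sub_le hq (by omega)
  have h3 := (Set.ncard_le_ncard (conePolynomials_subset (F := F) (m := m) hk) (by
    rw [hS]
    refine Set.Finite.union ((Set.finite_range _).subset fun a ha => ha.2) ?_
    exact S.finite_toSet.biUnion fun e _ => Set.finite_range _)).trans (Set.ncard_union_le _ _)
  rw [hS] at h3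
  have h4 : q ^ m ≤ q ^ (m + 2) := Nat.pow_le_pow_right (by omega) (by omega)
  calc _ ≤ (_ + _) * q ^ (ℓ - 3 * k) := Nat.mul_le_mul_right _ h3
    _ ≤ 3 * q ^ (m + 2) := by
      rw [add_mul]
      omega

end Cone

/-! ### The sum over all cubic forms -/

theorem addChar_map_sum {A M ι : Type*} [AddCommMonoid A] [CommMonoid M] (ψ : AddChar A M)
    (s : Finset ι) (f : ι → A) : ψ (∑ i ∈ s, f i) = ∏ i ∈ s, ψ (f i) := by
  classical
  induction s using Finset.induction_on with
  | empty => simp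
  | insert i s hi ih => rw [Finset.sum_insert hi, Finset.prod_insert hi, AddChar.map_add_eq_mul, ih]

theorem sum_addChar_linearMap {F : Type u} [Field F] {ψ : AddChar F ℂ} (hψ : ψ ≠ 1)
    {V : Type*} [AddCommGroup V] [Module F V] [Fintype V] (Φ : V →ₗ[F] F) [Decidable (Φ = 0)] :
    ∑ v, ψ (Φ v) = if Φ = 0 then (Nat.card V : ℂ) else 0 := by
  split_ifs with h
  · simp [h]
  · obtain ⟨a, ha⟩ := AddChar.ne_one_iff.mp hψ
    obtain ⟨v, hv⟩ := LinearMap.surjective h a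
    have hne : ψ.compAddMonoidHom Φ.toAddMonoidHom ≠ 1 :=
      AddChar.ne_one_iff.mpr ⟨v, by
        change ψ (Φ v) ≠ 1
        rwa [hv]⟩
    exact AddChar.sum_eq_zero_of_ne_one hne

section FullSum

open ClosedPoint

variable {F : Type u} [Field F]

theorem mem_cubicForms {ℓ k : ℕ} (hk : 3 * k ≤ ℓ) {s : Fin 4 → MvPolynomial (Fin 2) F} :
    s ∈ cubicForms F ℓ k ↔ ∀ i : Fin 4, (s i).IsHomogeneous (ℓ - (i : ℕ) * k) := by
  have h : ∀ i : Fin 4, ((ℓ : ℤ) - (i : ℕ) * k) = ((ℓ - (i : ℕ) * k : ℕ) : ℤ) := by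
    intro i
    have : (i : ℕ) * k ≤ 3 * k := Nat.mul_le_mul_right k (by omega)
    push_cast [Nat.cast_sub (this.trans hk)]
    ring
  simp only [cubicForms, surfaceSections, Submodule.mem_pi, Set.mem_univ, true_imp_iff, h,
    mem_lineSections_natCast]

instance finite_cubicForms [Finite F] (ℓ k : ℕ) : Finite (cubicForms F ℓ k) := by
  refine Set.Finite.to_subtype (Set.Finite.subset (Set.Finite.pi' fun i : Fin 4 =>
    finite_lineSections F ((ℓ : ℤ) - (i : ℕ) * k)) fun s hs i => ?_)
  exact hs i (Set.mem_univ i)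

theorem natCard_cubicForms [Finite F] {ℓ k : ℕ} (hk : 3 * k ≤ ℓ) :
    Nat.card (cubicForms F ℓ k) = Nat.card F ^ (4 * ℓ - 6 * k + 4) := by
  have e : cubicForms F ℓ k ≃ ∀ i : Fin 4, lineSections F ((ℓ - (i : ℕ) * k : ℕ) : ℤ) :=
    { toFun := fun s i => ⟨s.1 i, mem_lineSections_natCast.mpr ((mem_cubicForms hk).mp s.2 i)⟩
      invFun := fun t => ⟨fun i => (t i).1,
        (mem_cubicForms hk).mpr fun i => mem_lineSections_natCast.mp (t i).2⟩
      left_inv := fun _ => rfl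
      right_inv := fun _ => rfl }
  rw [Nat.card_congr e, Nat.card_pi]
  simp only [natCard_lineSections, Fin.prod_univ_four]
  rw [← pow_add, ← pow_add, ← pow_add]
  congr 1
  simp
  omega

/-- The functional `s ↦ ∑_P res_P (w_P · s(P))`. -/
def pairing (D : Finset (ClosedPoint F)) (w : ∀ P : D, Fin 4 → P.1.residueField) :
    (Fin 4 → MvPolynomial (Fin 2) F) →ₗ[F] F :=
  ∑ P : D, P.1.residue ∘ₗ ∑ i, LinearMap.mulLeft F (w P i) ∘ₗ
    (aeval P.1.coordinates).toLinearMap ∘ₗ LinearMap.proj i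

theorem pairing_apply (D : Finset (ClosedPoint F)) (w : ∀ P : D, Fin 4 → P.1.residueField)
    (s : Fin 4 → MvPolynomial (Fin 2) F) :
    pairing D w s = ∑ P : D, P.1.residue (∑ i, w P i * aeval P.1.coordinates (s i)) := by
  simp [pairing, LinearMap.sum_apply]

theorem pairing_single (D : Finset (ClosedPoint F)) (w : ∀ P : D, Fin 4 → P.1.residueField)
    (i : Fin 4) (A : MvPolynomial (Fin 2) F) :
    pairing D w (Pi.single i A) = ∑ P : D, P.1.residue (w P i * aeval P.1.coordinates A) := by
  rw [pairing_apply]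
  refine Finset.sum_congr rfl fun P _ => ?_
  rw [Finset.sum_eq_single i]
  · rw [Pi.single_eq_same]
  · intro j _ hj
    rw [Pi.single_eq_of_ne hj, map_zero, mul_zero]
  · simp

theorem card_mul_adjustedRootCount [Finite F] {ψ : AddChar F ℂ} (hψ : ψ ≠ 1)
    (D : Finset (ClosedPoint F)) (s : Fin 4 → MvPolynomial (Fin 2) F)
    [Fintype (∀ P : D, ConeIndex P.1.residueField)] :
    (Nat.card F : ℂ) ^ divisorDegree D * adjustedRootCount D s
      = ∑ w : ∀ P : D, ConeIndex P.1.residueField,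
          ψ (pairing D (fun P => conePoint (w P)) s) := by
  classical
  have : ∀ P : ClosedPoint F, Fintype P.residueField := fun P => Fintype.ofFinite _
  have : ∀ P : D, Fintype (ConeIndex P.1.residueField) := fun P => Fintype.ofFinite _
  have h : ∀ w : ∀ P : D, ConeIndex P.1.residueField,
      ψ (pairing D (fun P => conePoint (w P)) s) = ∏ P : D, P.1.residueChar ψ
        (∑ i, conePoint (w P) i * aeval P.1.coordinates (s i)) := by
    intro w
    rw [pairing_apply, addChar_map_sum]
    rfl
  have h2 : ∑ w : ∀ P : D, ConeIndex P.1.residueField,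
      ψ (pairing D (fun P => conePoint (w P)) s) = ∏ P : D, ∑ j : ConeIndex P.1.residueField,
        P.1.residueChar ψ (∑ i, conePoint j i * aeval P.1.coordinates (s i)) := by
    rw [Finset.prod_univ_sum, Fintype.piFinset_univ]
    simp only [h]
    congr!
  rw [h2, adjustedRootCount, divisorDegree, ← Finset.prod_pow_eq_pow_sum]
  push_cast
  rw [← Finset.prod_mul_distrib, ← Finset.prod_coe_sort]
  refine Finset.prod_congr rfl fun P _ => ?_
  rw [sum_addChar_conePoint (P.1.residueChar_isPrimitive hψ), natCard_residueField]
  push_cast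
  rfl

/-- The families of cone points at `D` that are orthogonal to all cubic forms. -/
def orthogonalConePoints (D : Finset (ClosedPoint F)) (ℓ k : ℕ) :
    Set (∀ P : D, ConeIndex P.1.residueField) :=
  {w | ∀ s ∈ cubicForms F ℓ k, pairing D (fun P => conePoint (w P)) s = 0}

/-- After exchanging the sums, the character sum over the forms is the size of the space when the
functional is zero on it, and zero otherwise. -/
theorem card_mul_sum_adjustedRootCount [Finite F] (D : Finset (ClosedPoint F)) (ℓ k : ℕ)
    [Fintype (cubicForms F ℓ k)] :
    (Nat.card F : ℤ) ^ divisorDegree D * ∑ s : cubicForms F ℓ k, adjustedRootCount D s.1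
      = Nat.card (cubicForms F ℓ k) * (orthogonalConePoints D ℓ k).ncard := by
  classical
  obtain ⟨ψ, hψ⟩ : ∃ ψ : AddChar F ℂ, ψ ≠ 1 := by
    have := AddChar.FiniteField.primitiveChar_to_Complex_isPrimitive F
    exact ⟨_, by simpa using this one_ne_zero⟩
  have := Fintype.ofFinite (∀ P : D, ConeIndex P.1.residueField)
  have h : (Nat.card F : ℂ) ^ divisorDegree D
      * ∑ s : cubicForms F ℓ k, (adjustedRootCount D s.1 : ℂ)
      = Nat.card (cubicForms F ℓ k) * (orthogonalConePoints D ℓ k).ncard := by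
    rw [Finset.mul_sum]
    simp only [card_mul_adjustedRootCount hψ]
    rw [Finset.sum_comm]
    have h1 : ∀ w : ∀ P : D, ConeIndex P.1.residueField,
        ∑ s : cubicForms F ℓ k, ψ (pairing D (fun P => conePoint (w P)) s.1)
          = if w ∈ orthogonalConePoints D ℓ k then (Nat.card (cubicForms F ℓ k) : ℂ) else 0 := by
      intro w
      have := sum_addChar_linearMap hψ
        ((pairing D (fun P => conePoint (w P))).domRestrict (cubicForms F ℓ k))
      simp only [LinearMap.domRestrict_apply] at this
      rw [this]
      congr 1
      refine propext ⟨fun h s hs => ?_, fun h => LinearMap.ext fun s => h s.1 s.2⟩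
      exact LinearMap.congr_fun h ⟨s, hs⟩
    simp only [h1]
    rw [← Finset.sum_filter, Finset.sum_const, nsmul_eq_mul, mul_comm,
      Set.ncard_eq_toFinset_card']
    congr 3
    ext w
    simp
  exact_mod_cast h

/-- The polynomial point of the cone attached to a family of cone points. -/
def interpolateCone (D : Finset (ClosedPoint F)) (w : ∀ P : D, ConeIndex P.1.residueField) :
    Fin 4 → Polynomial F :=
  fun i => interpolate D fun P => conePoint (w P) i

theorem single_mem_cubicForms {ℓ k : ℕ} (hk : 3 * k ≤ ℓ) (i : Fin 4)
    {A : MvPolynomial (Fin 2) F} (hA : A.IsHomogeneous (ℓ - (i : ℕ) * k)) :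
    Pi.single i A ∈ cubicForms F ℓ k := by
  rw [mem_cubicForms hk]
  intro j
  by_cases hj : j = i
  · subst hj
    rwa [Pi.single_eq_same]
  · rw [Pi.single_eq_of_ne hj]
    exact isHomogeneous_zero _ _ _

theorem interpolateCone_injOn (D : Finset (ClosedPoint F)) {ℓ k : ℕ} (hk : 3 * k ≤ ℓ) :
    Set.InjOn (interpolateCone D) (orthogonalConePoints D ℓ k) := by
  intro w hw w' hw' h
  have key : ∀ i : Fin 4, (fun P : D => conePoint (w P) i) - (fun P : D => conePoint (w' P) i) = 0 := by
    intro i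
    refine eq_zero_of_interpolate_eq_zero (n := ℓ - (i : ℕ) * k) ?_ ?_
    · rw [map_sub]
      exact sub_eq_zero.mpr (congrFun h i)
    · have hs := single_mem_cubicForms hk i
        (isHomogeneous_X_pow (R := F) (0 : Fin 2) (ℓ - (i : ℕ) * k))
      have h1 := hw _ hs
      have h2 := hw' _ hs
      rw [pairing_single] at h1 h2
      simp only [Pi.sub_apply, sub_mul, map_sub, Finset.sum_sub_distrib]
      rw [h1, h2, sub_zero]
  funext P
  refine conePoint_injective (funext fun i => ?_)
  exact sub_eq_zero.mp (congrFun (key i) P)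

theorem natDegree_interpolateCone {D : Finset (ClosedPoint F)} {ℓ k : ℕ} (hk : 3 * k ≤ ℓ)
    {w : ∀ P : D, ConeIndex P.1.residueField} (hw : w ∈ orthogonalConePoints D ℓ k) {i : Fin 4}
    (h0 : interpolateCone D w i ≠ 0) :
    (interpolateCone D w i).natDegree + (ℓ - (i : ℕ) * k) < (affineModulus D).natDegree := by
  refine natDegree_interpolate_add_lt (fun j hj => ?_) h0
  rw [← pairing_single D (fun P => conePoint (w P))]
  refine hw _ (single_mem_cubicForms hk i ?_)
  have := (isHomogeneous_X_pow (R := F) (0 : Fin 2) j).mul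
    (isHomogeneous_X_pow 1 (ℓ - (i : ℕ) * k - j))
  rwa [Nat.add_sub_cancel' hj.le] at this

/-- Modulo each finite point both sides are the cone equation times the square of the cofactor, so
the modulus divides their difference. Orthogonality bounds the degree of each product below that of
the modulus, so the difference is zero. -/
theorem interpolateCone_mul_eq {D : Finset (ClosedPoint F)} {ℓ k : ℕ} (hk : 3 * k ≤ ℓ)
    (hD : divisorDegree D + 5 * k ≤ 2 * ℓ)
    {w : ∀ P : D, ConeIndex P.1.residueField} (hw : w ∈ orthogonalConePoints D ℓ k)
    {a b c d : Fin 4} (hab : (a : ℕ) + b ≤ 4) (hcd : (c : ℕ) + d ≤ 4)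
    (h : ∀ P : D, conePoint (w P) a * conePoint (w P) b = conePoint (w P) c * conePoint (w P) d) :
    interpolateCone D w a * interpolateCone D w b
      = interpolateCone D w c * interpolateCone D w d := by
  have hm : (affineModulus D).natDegree ≤ divisorDegree D := by
    rw [← natDegree_affineModulus]
    exact Nat.le_add_right _ _
  have hdeg : ∀ {i j : Fin 4}, (i : ℕ) + j ≤ 4 →
      (interpolateCone D w i * interpolateCone D w j).degree < (affineModulus D).degree := by
    intro i j hij
    by_cases hi : interpolateCone D w i = 0
    · rw [hi, zero_mul, Polynomial.degree_zero]
      exact bot_lt_iff_ne_bot.mpr (Polynomial.degree_ne_bot.mpr (affineModulus_monic D).ne_zero)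
    by_cases hj : interpolateCone D w j = 0
    · rw [hj, mul_zero, Polynomial.degree_zero]
      exact bot_lt_iff_ne_bot.mpr (Polynomial.degree_ne_bot.mpr (affineModulus_monic D).ne_zero)
    refine Polynomial.degree_lt_degree ?_
    rw [Polynomial.natDegree_mul hi hj]
    have h1 := natDegree_interpolateCone hk hw hi
    have h2 := natDegree_interpolateCone hk hw hj
    -- Index sums in the cone equations are 2, 3 and 4; the largest is the worst case for the degree
    -- bound.
    have h3 : (i : ℕ) * k + j * k ≤ 4 * k := by
      rw [← add_mul]
      exact Nat.mul_le_mul_right k hij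
    omega
  rw [← sub_eq_zero]
  refine Polynomial.eq_zero_of_dvd_of_degree_lt (affineModulus_dvd fun P hP hi => ?_)
    ((Polynomial.degree_sub_le _ _).trans_lt (max_lt (hdeg hab) (hdeg hcd)))
  have hev : ∀ i, AdjoinRoot.mk P.equation (interpolateCone D w i)
      = conePoint (w ⟨P, hP⟩) i * AdjoinRoot.mk P.equation (cofactor D P) :=
    fun i => mk_interpolate (fun P => conePoint (w P) i) ⟨P, hP⟩ hi
  rw [map_sub, map_mul, map_mul, hev, hev, hev, hev]
  linear_combination (AdjoinRoot.mk P.equation (cofactor D P)) ^ 2 * h ⟨P, hP⟩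

theorem zero_mem_orthogonalConePoints (D : Finset (ClosedPoint F)) (ℓ k : ℕ) :
    (fun _ => Sum.inr 0) ∈ orthogonalConePoints D ℓ k := by
  intro s _
  rw [pairing_apply]
  refine Finset.sum_eq_zero fun P _ => ?_
  simp [conePoint, Fin.sum_univ_four]

theorem interpolateCone_zero (D : Finset (ClosedPoint F)) :
    interpolateCone D (fun _ => Sum.inr 0) = 0 := by
  funext i
  have h : (fun P : D => conePoint (Sum.inr 0 : ConeIndex P.1.residueField) i) = 0 := by
    funext P
    fin_cases i <;> simp [conePoint]
  rw [interpolateCone, h, map_zero]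
  rfl

theorem ncard_orthogonalConePoints_le [Finite F] (D : Finset (ClosedPoint F)) {ℓ k : ℕ}
    (hk : 3 * k ≤ ℓ) (hD : divisorDegree D + 5 * k ≤ 2 * ℓ) :
    ∃ n, (orthogonalConePoints D ℓ k).ncard = n + 1 ∧
      n * Nat.card F ^ (ℓ - 3 * k) ≤ 3 * Nat.card F ^ (divisorDegree D + 2) := by
  have hm : (affineModulus D).natDegree ≤ divisorDegree D := by
    rw [← natDegree_affineModulus]
    exact Nat.le_add_right _ _
  set z : ∀ P : D, ConeIndex P.1.residueField := fun _ => Sum.inr 0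
  have hz : z ∈ orthogonalConePoints D ℓ k := zero_mem_orthogonalConePoints D ℓ k
  refine ⟨(orthogonalConePoints D ℓ k \ {z}).ncard,
    (Set.ncard_sdiff_singleton_add_one hz (Set.toFinite _)).symm, ?_⟩
  have hle : (orthogonalConePoints D ℓ k \ {z}).ncard
      ≤ (conePolynomials F (affineModulus D).natDegree ℓ k).ncard := by
    refine Set.ncard_le_ncard_of_injOn (interpolateCone D) ?_
      ((interpolateCone_injOn D hk).mono Set.sdiff_subset) (finite_conePolynomials hk)
    rintro w ⟨hw, hwz⟩
    refine ⟨fun h => hwz ?_, ⟨?_, ?_, ?_⟩, fun i hi => ?_⟩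
    · exact interpolateCone_injOn D hk hw hz (h.trans (interpolateCone_zero D).symm)
    · exact interpolateCone_mul_eq hk hD hw (by decide) (by decide)
        fun P => (isConePoint_conePoint (w P)).1
    · exact interpolateCone_mul_eq hk hD hw (by decide) (by decide)
        fun P => (isConePoint_conePoint (w P)).2.1
    · exact interpolateCone_mul_eq hk hD hw (by decide) (by decide)
        fun P => (isConePoint_conePoint (w P)).2.2
    · have := natDegree_interpolateCone hk hw hi
      omega
  calc _ ≤ _ := Nat.mul_le_mul_right _ hle
    _ ≤ _ := ncard_conePolynomials_le hk
    _ ≤ _ := Nat.mul_le_mul_left 3 (Nat.pow_le_pow_right Nat.card_pos (by omega))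

theorem abs_sum_cubicForms_sub_le [Finite F] (D : Finset (ClosedPoint F)) {ℓ k : ℕ}
    (hk : 3 * k ≤ ℓ) (hD : divisorDegree D + 5 * k ≤ 2 * ℓ) [Fintype (cubicForms F ℓ k)] :
    |((∑ s : cubicForms F ℓ k, adjustedRootCount D s.1 : ℤ) : ℝ)
        - (Nat.card F : ℝ) ^ (4 * (ℓ : ℤ) - 6 * (k : ℤ) + 4 - (divisorDegree D : ℤ))|
      ≤ 3 * (Nat.card F : ℝ) ^ 6 * (Nat.card F : ℝ) ^ (3 * (ℓ : ℤ) - 3 * (k : ℤ)) := by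
  obtain ⟨n, hn, hle⟩ := ncard_orthogonalConePoints_le D hk hD
  have h := card_mul_sum_adjustedRootCount D ℓ k
  rw [hn, natCard_cubicForms hk] at h
  set A : ℤ := ∑ s : cubicForms F ℓ k, adjustedRootCount D s.1
  set d := divisorDegree D
  have hq : (0 : ℝ) < Nat.card F := by exact_mod_cast Nat.card_pos
  have hR : (Nat.card F : ℝ) ^ d * (A : ℝ) = (Nat.card F : ℝ) ^ (4 * ℓ - 6 * k + 4) * (n + 1) := by
    exact_mod_cast h
  have hleR : (n : ℝ) * (Nat.card F : ℝ) ^ (ℓ - 3 * k) ≤ 3 * (Nat.card F : ℝ) ^ (d + 2) := by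
    exact_mod_cast hle
  set q : ℝ := (Nat.card F : ℝ)
  have e1 : q ^ (4 * (ℓ : ℤ) - 6 * (k : ℤ) + 4 - (d : ℤ)) * q ^ d = q ^ (4 * ℓ - 6 * k + 4) := by
    rw [← zpow_natCast, ← zpow_natCast, ← zpow_add₀ hq.ne']
    congr 1
    omega
  have e2 : q ^ (3 * (ℓ : ℤ) - 3 * (k : ℤ)) = q ^ (3 * ℓ - 3 * k) := by
    rw [← zpow_natCast]
    congr 1
    omega
  have e3 : (A : ℝ) - q ^ (4 * (ℓ : ℤ) - 6 * (k : ℤ) + 4 - (d : ℤ))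
      = q ^ (4 * ℓ - 6 * k + 4) * n / q ^ d := by
    rw [eq_div_iff (pow_pos hq d).ne', sub_mul, e1]
    linear_combination hR
  rw [e3, abs_of_nonneg (by positivity), e2, div_le_iff₀ (pow_pos hq d)]
  have e4 : q ^ (4 * ℓ - 6 * k + 4) = q ^ (3 * ℓ - 3 * k + 4) * q ^ (ℓ - 3 * k) := by
    rw [← pow_add]
    congr 1
    omega
  calc q ^ (4 * ℓ - 6 * k + 4) * n = q ^ (3 * ℓ - 3 * k + 4) * (n * q ^ (ℓ - 3 * k)) := by
        rw [e4]; ring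
    _ ≤ q ^ (3 * ℓ - 3 * k + 4) * (3 * q ^ (d + 2)) := by gcongr
    _ = 3 * q ^ 6 * q ^ (3 * ℓ - 3 * k) * q ^ d := by ring

end FullSum

/-! ### Sections that vanish on fibres -/

section Vanishing

open ClosedPoint

variable {F : Type u} [Field F]

/-- All coefficients of a section vanish at `P`: the section vanishes on the fibre above `P`. -/
def VanishesAt {m : ℕ} (P : ClosedPoint F) (s : Fin (m + 1) → MvPolynomial (Fin 2) F) : Prop :=
  ∀ i, aeval P.coordinates (s i) = 0

open Classical in
theorem abs_rootCount_sub_one_le [Finite F] (P : ClosedPoint F)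
    (s : Fin 4 → MvPolynomial (Fin 2) F) :
    |(P.rootCount s : ℤ) - 1|
      ≤ ((2 * (1 + if VanishesAt P s then Nat.card F ^ P.degree else 0) : ℕ) : ℤ) := by
  split_ifs with h
  · have h0 : (fun i => aeval P.coordinates (s i)) = 0 := funext h
    have hr : P.rootCount s = Nat.card F ^ P.degree + 1 := by
      rw [rootCount, restrict, h0, natCard_roots_zero, natCard_residueField]
    rw [hr]
    push_cast
    rw [add_sub_cancel_right, abs_of_nonneg (by positivity)]
    have : (0 : ℤ) ≤ (Nat.card F : ℤ) ^ P.degree := by positivity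
    linarith
  · have hr : P.rootCount s ≤ 3 := natCard_roots_le fun h0 => h fun i => congrFun h0 i
    rw [abs_le]
    constructor <;> push_cast <;> omega

open Classical in
theorem abs_adjustedRootCount_le [Finite F] (D : Finset (ClosedPoint F))
    (s : Fin 4 → MvPolynomial (Fin 2) F) :
    |adjustedRootCount D s|
      ≤ ((2 ^ D.card * ∑ E ∈ D.powerset,
          if ∀ P ∈ E, VanishesAt P s then Nat.card F ^ divisorDegree E else 0 : ℕ) : ℤ) := by
  rw [adjustedRootCount, Finset.abs_prod]
  refine (Finset.prod_le_prod (fun P _ => abs_nonneg _)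
    fun P _ => abs_rootCount_sub_one_le P s).trans_eq ?_
  rw [← Nat.cast_prod]
  congr 1
  rw [Finset.prod_mul_distrib, Finset.prod_const, Finset.prod_one_add]
  congr 1
  refine Finset.sum_congr rfl fun E _ => ?_
  split_ifs with h
  · rw [divisorDegree, ← Finset.prod_pow_eq_pow_sum]
    exact Finset.prod_congr rfl fun P hP => if_pos (h P hP)
  · push Not at h
    obtain ⟨P, hP, hv⟩ := h
    exact Finset.prod_eq_zero hP (if_neg hv)

-- Expanding `∏ (1 + [s vanishes at P] q^(deg P))` over subsets `E` reduces the sum to counts of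
-- forms vanishing over `E`. The allowance `c ^ |E|` resums to `(1 + c) ^ |D|`.
open Classical in
theorem abs_sum_adjustedRootCount_le [Finite F] (D : Finset (ClosedPoint F))
    (T : Finset (Fin 4 → MvPolynomial (Fin 2) F)) (c M : ℕ)
    (h : ∀ E ⊆ D, Nat.card F ^ divisorDegree E * (T.filter fun s => ∀ P ∈ E, VanishesAt P s).card
      ≤ c ^ E.card * M) :
    |∑ s ∈ T, adjustedRootCount D s| ≤ (((2 * (1 + c)) ^ D.card * M : ℕ) : ℤ) := by
  refine (Finset.abs_sum_le_sum_abs _ _).trans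
    ((Finset.sum_le_sum fun s _ => abs_adjustedRootCount_le D s).trans ?_)
  rw [← Nat.cast_sum, ← Finset.mul_sum, Finset.sum_comm, mul_pow, mul_assoc]
  refine Nat.cast_le.mpr (Nat.mul_le_mul_left _ ?_)
  have h1 : (1 + c) ^ D.card = ∑ E ∈ D.powerset, c ^ E.card := by
    rw [← Finset.prod_const, Finset.prod_one_add]
    simp only [Finset.prod_const]
  rw [h1, Finset.sum_mul]
  refine Finset.sum_le_sum fun E hE => ?_
  rw [← Finset.sum_filter, Finset.sum_const, smul_eq_mul, mul_comm]
  exact h E (Finset.mem_powerset.mp hE)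

/-- The forms of degree `n` on the projective line that vanish on a divisor. -/
def vanishingSections (E : Finset (ClosedPoint F)) (n : ℤ) : Set (MvPolynomial (Fin 2) F) :=
  {A | A ∈ lineSections F n ∧ ∀ P ∈ E, aeval P.coordinates A = 0}

theorem finite_vanishingSections [Finite F] (E : Finset (ClosedPoint F)) (n : ℤ) :
    (vanishingSections E n).Finite :=
  (finite_lineSections F n).subset fun _ hA => hA.1

theorem affineModulus_dvd_dehomogenize {E : Finset (ClosedPoint F)} {n : ℤ}
    {A : MvPolynomial (Fin 2) F} (hA : A ∈ vanishingSections E n) :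
    affineModulus E ∣ dehomogenize A := by
  refine affineModulus_dvd fun P hP hi => ?_
  cases P with
  | infinity => exact absurd rfl hi
  | finite f h h' =>
    rw [← aeval_coordinates_finite]
    exact hA.2 _ hP

/-- Vanishing at infinity means that the coefficient of `t ^ n` is zero, which lowers the degree by
at least one. -/
theorem natDegree_dehomogenize_add_le {E : Finset (ClosedPoint F)} {n : ℤ}
    {A : MvPolynomial (Fin 2) F} (hA : A ∈ vanishingSections E n) (h0 : A ≠ 0) :
    ((dehomogenize A).natDegree + ∑ P ∈ E, P.infinityDegree : ℕ) ≤ n := by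
  classical
  have hn := nonneg_of_mem_lineSections hA.1 h0
  have hd0 := dehomogenize_ne_zero hA.1 h0
  have hhom := (mem_lineSections_of_nonneg hn).mp hA.1
  have hle := natDegree_dehomogenize_le hhom
  by_cases hi : infinity ∈ E
  · have hs : ∑ P ∈ E, P.infinityDegree = 1 := by
      rw [Finset.sum_eq_single_of_mem _ hi]
      · rfl
      · intro P _ hP
        cases P with
        | infinity => exact absurd rfl hP
        | finite f h h' => rfl
    have hc : (dehomogenize A).coeff n.toNat = 0 := by
      have := hA.2 _ hi
      rw [aeval_coordinates_infinity hhom] at this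
      exact (map_eq_zero _).mp this
    have hne : (dehomogenize A).natDegree ≠ n.toNat := by
      intro h
      rw [← h, Polynomial.coeff_natDegree, Polynomial.leadingCoeff_eq_zero] at hc
      exact hd0 hc
    omega
  · have hs : ∑ P ∈ E, P.infinityDegree = 0 := by
      refine Finset.sum_eq_zero fun P hP => ?_
      cases P with
      | infinity => exact absurd hP hi
      | finite f h h' => rfl
    omega

theorem divisorDegree_le {E : Finset (ClosedPoint F)} {n : ℤ}
    {A : MvPolynomial (Fin 2) F} (hA : A ∈ vanishingSections E n) (h0 : A ≠ 0) :
    (divisorDegree E : ℤ) ≤ n := by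
  have h1 := natDegree_dehomogenize_add_le hA h0
  have h2 := Polynomial.natDegree_le_of_dvd (affineModulus_dvd_dehomogenize hA)
    (dehomogenize_ne_zero hA.1 h0)
  have h3 := natDegree_affineModulus E
  omega

theorem ncard_vanishingSections_le [Finite F] (E : Finset (ClosedPoint F)) (n : ℤ) :
    (vanishingSections E n).ncard ≤ Nat.card F ^ (n + 1 - divisorDegree E).toNat := by
  have hcard : (Polynomial.degreeLT F (n + 1 - divisorDegree E).toNat : Set (Polynomial F)).ncard
      = Nat.card F ^ (n + 1 - divisorDegree E).toNat :=
    natCard_degreeLT F _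
  rw [← hcard]
  refine Set.ncard_le_ncard_of_injOn (fun A => dehomogenize A /ₘ affineModulus E) ?_ ?_
    (finite_degreeLT F _)
  · intro A hA
    by_cases h0 : A = 0
    · simp [h0]
    refine mem_degreeLT_of_natDegree_lt ?_
    have h1 := natDegree_dehomogenize_add_le hA h0
    have h2 := Polynomial.natDegree_le_of_dvd (affineModulus_dvd_dehomogenize hA)
      (dehomogenize_ne_zero hA.1 h0)
    have h3 := natDegree_affineModulus E
    rw [Polynomial.natDegree_divByMonic _ (affineModulus_monic E)]
    omega
  · intro A hA B hB h
    refine dehomogenize_injOn n hA.1 hB.1 ?_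
    have key : ∀ {C}, C ∈ vanishingSections E n →
        affineModulus E * (dehomogenize C /ₘ affineModulus E) = dehomogenize C := by
      intro C hC
      have h1 := Polynomial.modByMonic_add_div (dehomogenize C) (affineModulus E)
      rwa [(Polynomial.modByMonic_eq_zero_iff_dvd (affineModulus_monic E)).mpr
        (affineModulus_dvd_dehomogenize hC), zero_add] at h1
    rw [← key hA, ← key hB]
    exact congrArg _ h

theorem ncard_univ_pi {ι α : Type*} [Fintype ι] (t : ι → Set α) :
    (Set.univ.pi t).ncard = ∏ i, (t i).ncard := by
  rw [← Nat.card_coe_set_eq, Nat.card_congr (Equiv.Set.univPi t), Nat.card_pi]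
  rfl

theorem divisorDegree_mono {E D : Finset (ClosedPoint F)} (h : E ⊆ D) :
    divisorDegree E ≤ divisorDegree D :=
  Finset.sum_le_sum_of_subset h

/-! ### The sum over the reducible cubic forms -/

-- Only three coefficients are free. If one of their spaces is not cut to zero dimension, its loss
-- of `deg E` absorbs the prefactor; otherwise `hE` bounds `deg E` directly.
open Classical in
theorem card_filter_coeff_zero_le [Finite F] {ℓ k : ℕ} (hk : 3 * k ≤ ℓ)
    {E : Finset (ClosedPoint F)} (hE : divisorDegree E + 5 * k ≤ 2 * ℓ)
    {T : Finset (Fin 4 → MvPolynomial (Fin 2) F)}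
    (hT : ∀ s ∈ T, s ∈ cubicForms F ℓ k ∧ s 3 = 0) :
    Nat.card F ^ divisorDegree E * (T.filter fun s => ∀ P ∈ E, VanishesAt P s).card
      ≤ Nat.card F ^ (3 * ℓ - 3 * k + 3) := by
  let t : Fin 4 → Set (MvPolynomial (Fin 2) F) :=
    ![vanishingSections E ℓ, vanishingSections E (ℓ - k), vanishingSections E (ℓ - 2 * k), {0}]
  have hfin : (Set.univ.pi t).Finite := by
    refine Set.Finite.pi fun i => ?_
    fin_cases i
    · exact finite_vanishingSections _ _
    · exact finite_vanishingSections _ _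
    · exact finite_vanishingSections _ _
    · exact Set.finite_singleton 0
  have hsub : ((T.filter fun s => ∀ P ∈ E, VanishesAt P s : Finset _) : Set _)
      ⊆ Set.univ.pi t := by
    intro s hs i _
    simp only [Finset.coe_filter, Set.mem_ofPred_eq] at hs
    obtain ⟨hs1, hs2⟩ := hT s hs.1
    have hi := hs1 i (Set.mem_univ i)
    fin_cases i
    · exact ⟨by simpa using hi, fun P hP => hs.2 P hP 0⟩
    · exact ⟨by simpa using hi, fun P hP => hs.2 P hP 1⟩
    · exact ⟨by simpa using hi, fun P hP => hs.2 P hP 2⟩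
    · exact hs2
  have hcard := Set.ncard_le_ncard hsub hfin
  rw [Set.ncard_coe_finset, ncard_univ_pi, Fin.prod_univ_four] at hcard
  have hq : 0 < Nat.card F := Nat.card_pos
  have hb : (t 0).ncard * (t 1).ncard * (t 2).ncard * (t 3).ncard
      ≤ Nat.card F ^ ((ℓ : ℤ) + 1 - divisorDegree E).toNat
        * Nat.card F ^ ((ℓ : ℤ) - k + 1 - divisorDegree E).toNat
        * Nat.card F ^ ((ℓ : ℤ) - 2 * k + 1 - divisorDegree E).toNat * 1 := by
    gcongr
    · exact ncard_vanishingSections_le E _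
    · exact ncard_vanishingSections_le E _
    · exact ncard_vanishingSections_le E _
    · simp [t]
  refine (Nat.mul_le_mul_left _ (hcard.trans hb)).trans ?_
  rw [mul_one, ← pow_add, ← pow_add, ← pow_add]
  exact Nat.pow_le_pow_right hq (by omega)

/-- The sections of `𝒪(m, b)` with nonzero last coefficient that vanish on the fibres over `E`. -/
def vanishingFactors (E : Finset (ClosedPoint F)) (k m : ℕ) (b : ℤ) :
    Set (Fin (m + 1) → MvPolynomial (Fin 2) F) :=
  {B | B (Fin.last m) ≠ 0 ∧ ∀ i : Fin (m + 1), B i ∈ vanishingSections E (b - (i : ℕ) * k)}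

theorem finite_vanishingFactors [Finite F] (E : Finset (ClosedPoint F)) (k m : ℕ) (b : ℤ) :
    (vanishingFactors E k m b).Finite :=
  (Set.Finite.pi' fun i : Fin (m + 1) => finite_vanishingSections E (b - (i : ℕ) * k)).subset
    fun _ hB i => hB.2 i

theorem ncard_vanishingFactors_le [Finite F] (E : Finset (ClosedPoint F)) (k m : ℕ) (b : ℤ) :
    (vanishingFactors E k m b).ncard
      ≤ ∏ i : Fin (m + 1), Nat.card F ^ (b - (i : ℕ) * k + 1 - divisorDegree E).toNat := by
  have hsub : vanishingFactors E k m b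
      ⊆ Set.univ.pi fun i : Fin (m + 1) => vanishingSections E (b - (i : ℕ) * k) :=
    fun B hB i _ => hB.2 i
  refine (Set.ncard_le_ncard hsub ?_).trans ?_
  · exact Set.Finite.pi fun i => finite_vanishingSections E _
  · rw [ncard_univ_pi]
    exact Finset.prod_le_prod' fun i _ => ncard_vanishingSections_le E _

theorem divisorDegree_le_of_mem_vanishingFactors {E : Finset (ClosedPoint F)} {k m : ℕ} {b : ℤ}
    {B : Fin (m + 1) → MvPolynomial (Fin 2) F} (hB : B ∈ vanishingFactors E k m b) :
    (divisorDegree E : ℤ) ≤ b - m * k := by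
  simpa using divisorDegree_le (hB.2 (Fin.last m)) hB.1

theorem ncard_products_le [Finite F] (E E' : Finset (ClosedPoint F)) {ℓ k c : ℕ}
    (hc : c + 2 * k ≤ ℓ) :
    Nat.card F ^ (divisorDegree E + divisorDegree E') *
      ((fun x : (Fin 3 → MvPolynomial (Fin 2) F) × (Fin 2 → MvPolynomial (Fin 2) F) =>
        mulCoeffs x.1 x.2) ''
        (vanishingFactors E k 2 ((ℓ : ℤ) - c) ×ˢ vanishingFactors E' k 1 c)).ncard
      ≤ Nat.card F ^ (3 * ℓ - 4 * k + 5 - c) := by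
  have hq : 0 < Nat.card F := Nat.card_pos
  by_cases hne : (vanishingFactors E k 2 ((ℓ : ℤ) - c) ×ˢ vanishingFactors E' k 1 c).Nonempty
  · obtain ⟨⟨B, L⟩, hB, hL⟩ := hne
    -- Nonzero last coefficients force `deg E ≤ ℓ - c - 2k` and `deg E' ≤ c - k`, so no exponent
    -- below is truncated at zero.
    have h1 := divisorDegree_le_of_mem_vanishingFactors hB
    have h2 := divisorDegree_le_of_mem_vanishingFactors hL
    have hB' := ncard_vanishingFactors_le E k 2 ((ℓ : ℤ) - c)
    have hL' := ncard_vanishingFactors_le E' k 1 (c : ℤ)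
    rw [Fin.prod_univ_three, ← pow_add, ← pow_add] at hB'
    rw [Fin.prod_univ_two, ← pow_add] at hL'
    have him := Set.ncard_image_le (f := fun x : (Fin 3 → MvPolynomial (Fin 2) F) ×
      (Fin 2 → MvPolynomial (Fin 2) F) => mulCoeffs x.1 x.2)
      ((finite_vanishingFactors E k 2 ((ℓ : ℤ) - c)).prod (finite_vanishingFactors E' k 1 c))
    rw [Set.ncard_prod] at him
    refine (Nat.mul_le_mul_left _ (him.trans (Nat.mul_le_mul hB' hL'))).trans ?_
    rw [← pow_add, ← pow_add]
    refine Nat.pow_le_pow_right hq ?_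
    simp only [Fin.val_zero, Fin.val_one, Fin.val_two] at *
    push_cast at *
    omega
  · rw [Set.not_nonempty_iff_eq_empty] at hne
    simp [hne]

/-- The last coefficient is the product of the last coefficients of the factors. Being nonzero, it
has a unique degree, which yields `b + c = ℓ` and the range of `c`. -/
theorem eq_mulCoeffs_of_horizontallyReducible {ℓ k : ℕ} (hk : 3 * k ≤ ℓ)
    {s : Fin 4 → MvPolynomial (Fin 2) F} (hs : s ∈ cubicForms F ℓ k) (h3 : s 3 ≠ 0)
    (hr : HorizontallyReducible k s) :
    ∃ c : ℕ, k ≤ c ∧ c + 2 * k ≤ ℓ ∧ ∃ B ∈ surfaceSections F k 2 ((ℓ : ℤ) - c),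
      ∃ L ∈ surfaceSections F k 1 (c : ℤ), s = mulCoeffs B L := by
  rcases hr with rfl | ⟨b, c, B, hB, L, hL, -, -, h⟩
  · exact absurd rfl h3
  rw [binaryForm_mul] at h
  have hs' := binaryForm_injective h
  have h3' : s 3 = B 2 * L 1 := by rw [hs']; rfl
  have hB2 : B 2 ≠ 0 := fun h => h3 (by rw [h3', h, zero_mul])
  have hL1 : L 1 ≠ 0 := fun h => h3 (by rw [h3', h, mul_zero])
  have mB := hB 2 (Set.mem_univ _)
  have mL := hL 1 (Set.mem_univ _)
  have nB := nonneg_of_mem_lineSections mB hB2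
  have nL := nonneg_of_mem_lineSections mL hL1
  have hom := ((mem_lineSections_of_nonneg nB).mp mB).mul ((mem_lineSections_of_nonneg nL).mp mL)
  rw [← h3'] at hom
  have heq := ((mem_cubicForms hk).mp hs 3).inj_right hom h3
  simp only [Fin.val_one, Fin.val_two] at nB nL heq
  have e3 : ((3 : Fin 4) : ℕ) = 3 := rfl
  rw [e3] at heq
  push_cast at nB nL heq
  lift c to ℕ using by omega
  have hb : b = (ℓ : ℤ) - c := by omega
  subst hb
  exact ⟨c, by omega, by omega, B, hB, L, hL, hs'⟩

theorem vanishesAt_or_of_mulCoeffs {P : ClosedPoint F} {B : Fin 3 → MvPolynomial (Fin 2) F}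
    {L : Fin 2 → MvPolynomial (Fin 2) F} (h : VanishesAt P (mulCoeffs B L)) :
    VanishesAt P B ∨ VanishesAt P L := by
  have h0 : mulCoeffs (fun i => aeval P.coordinates (B i)) (fun i => aeval P.coordinates (L i))
      = 0 := by
    rw [← show (fun i => aeval P.coordinates (mulCoeffs B L i)) = 0 from funext h]
    ext i
    fin_cases i <;> simp [mulCoeffs]
  exact (mulCoeffs_eq_zero h0).imp (fun h i => congrFun h i) fun h i => congrFun h i

-- Each form is assigned the set `E₁ ⊆ E` where its quadratic factor vanishes; the linear factor
-- vanishes on the rest. There are `2 ^ |E|` such splittings, and for each one the sum over `c` is a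
-- geometric series.
open Classical in
theorem card_filter_reducible_le [Finite F] {ℓ k : ℕ} (hk : 3 * k ≤ ℓ)
    (E : Finset (ClosedPoint F))
    {T : Finset (Fin 4 → MvPolynomial (Fin 2) F)}
    (hT : ∀ s ∈ T, s ∈ cubicForms F ℓ k ∧ s 3 ≠ 0 ∧ HorizontallyReducible k s) :
    Nat.card F ^ divisorDegree E * (T.filter fun s => ∀ P ∈ E, VanishesAt P s).card
      ≤ 2 ^ E.card * (2 * Nat.card F ^ (3 * ℓ - 3 * k + 5)) := by
  have hq : 2 ≤ Nat.card F := Finite.one_lt_card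
  let prods : Finset (ClosedPoint F) → ℕ → Set (Fin 4 → MvPolynomial (Fin 2) F) := fun E₁ c =>
    (fun x : (Fin 3 → MvPolynomial (Fin 2) F) × (Fin 2 → MvPolynomial (Fin 2) F) =>
        mulCoeffs x.1 x.2) ''
        (vanishingFactors E₁ k 2 ((ℓ : ℤ) - c) ×ˢ vanishingFactors (E \ E₁) k 1 c)
  have hfin : ∀ E₁ c, (prods E₁ c).Finite := fun E₁ c =>
    ((finite_vanishingFactors _ _ _ _).prod (finite_vanishingFactors _ _ _ _)).image _
  have hsub : ((T.filter fun s => ∀ P ∈ E, VanishesAt P s : Finset _) : Set _)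
      ⊆ ⋃ E₁ ∈ E.powerset, ⋃ c ∈ Finset.Icc k (ℓ - 2 * k), prods E₁ c := by
    intro s hs
    simp only [Finset.coe_filter, Set.mem_ofPred_eq] at hs
    obtain ⟨hs1, h3, hr⟩ := hT s hs.1
    obtain ⟨c, hc, hc', B, hB, L, hL, rfl⟩ := eq_mulCoeffs_of_horizontallyReducible hk hs1 h3 hr
    change B 2 * L 1 ≠ 0 at h3
    simp only [Set.mem_iUnion]
    refine ⟨E.filter fun P => VanishesAt P B, Finset.mem_powerset.mpr (Finset.filter_subset _ _),
      c, Finset.mem_Icc.mpr ⟨hc, by omega⟩, ⟨B, L⟩, ⟨⟨left_ne_zero_of_mul h3, fun i => ⟨?_, ?_⟩⟩,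
      ⟨right_ne_zero_of_mul h3, fun i => ⟨?_, ?_⟩⟩⟩, rfl⟩
    · exact hB i (Set.mem_univ i)
    · exact fun P hP => (Finset.mem_filter.mp hP).2 i
    · exact hL i (Set.mem_univ i)
    · intro P hP
      obtain ⟨hPE, hPB⟩ := Finset.mem_sdiff.mp hP
      refine (vanishesAt_or_of_mulCoeffs (hs.2 P hPE)).resolve_left (fun h => hPB ?_) i
      exact Finset.mem_filter.mpr ⟨hPE, h⟩
  have hcard := Set.ncard_le_ncard hsub (E.powerset.finite_toSet.biUnion fun E₁ _ =>
    (Finset.Icc k (ℓ - 2 * k)).finite_toSet.biUnion fun c _ => hfin E₁ c)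
  rw [Set.ncard_coe_finset] at hcard
  have hcard' := hcard.trans ((Finset.set_ncard_biUnion_le _ _).trans
    (Finset.sum_le_sum fun E₁ _ => Finset.set_ncard_biUnion_le _ _))
  refine (Nat.mul_le_mul_left _ hcard').trans ?_
  rw [Finset.mul_sum, ← Finset.card_powerset, ← smul_eq_mul (E.powerset.card), ← Finset.sum_const]
  refine Finset.sum_le_sum fun E₁ hE₁ => ?_
  rw [Finset.mul_sum]
  have hdeg : divisorDegree E = divisorDegree E₁ + divisorDegree (E \ E₁) := by
    rw [add_comm]
    exact (Finset.sum_sdiff (Finset.mem_powerset.mp hE₁)).symm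
  calc _ ≤ ∑ c ∈ Finset.Icc k (ℓ - 2 * k), Nat.card F ^ (3 * ℓ - 4 * k + 5 - c) := by
        refine Finset.sum_le_sum fun c hc => ?_
        rw [Finset.mem_Icc] at hc
        rw [hdeg]
        exact ncard_products_le E₁ (E \ E₁) (by omega)
    _ ≤ ∑ c ∈ Finset.range (ℓ + 1), Nat.card F ^ (3 * ℓ - 4 * k + 5 - c) := by
        refine Finset.sum_le_sum_of_subset fun c hc => ?_
        rw [Finset.mem_Icc] at hc
        exact Finset.mem_range.mpr (by omega)
    _ ≤ 2 * Nat.card F ^ (3 * ℓ - 4 * k + 5) := sum_pow_sub_le hq (by omega)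
    _ ≤ 2 * Nat.card F ^ (3 * ℓ - 3 * k + 5) :=
        Nat.mul_le_mul_left 2 (Nat.pow_le_pow_right (by omega) (by omega))

end Vanishing

/-! ### Removing the reducible forms from the full sum -/

section Main

variable {F : Type u} [Field F] [Finite F]

open Classical in
theorem abs_sum_reducible_le (D : Finset (ClosedPoint F)) {ℓ k : ℕ}
    (hk : 3 * k ≤ ℓ) (hD : divisorDegree D + 5 * k ≤ 2 * ℓ)
    {T : Finset (Fin 4 → MvPolynomial (Fin 2) F)}
    (hT : ∀ s ∈ T, s ∈ cubicForms F ℓ k ∧ HorizontallyReducible k s) :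
    |∑ s ∈ T, adjustedRootCount D s|
      ≤ ((6 ^ D.card * (3 * Nat.card F ^ (3 * ℓ - 3 * k + 5)) : ℕ) : ℤ) := by
  have h1 := abs_sum_adjustedRootCount_le D (T.filter fun s => s 3 = 0) 1
    (Nat.card F ^ (3 * ℓ - 3 * k + 3)) fun E hE => by
      rw [one_pow, one_mul]
      refine card_filter_coeff_zero_le hk ?_ fun s hs => ?_
      · have := divisorDegree_mono hE
        omega
      · rw [Finset.mem_filter] at hs
        exact ⟨(hT s hs.1).1, hs.2⟩
  have h2 := abs_sum_adjustedRootCount_le D (T.filter fun s => ¬ s 3 = 0) 2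
    (2 * Nat.card F ^ (3 * ℓ - 3 * k + 5)) fun E _ =>
      card_filter_reducible_le hk E fun s hs => by
        rw [Finset.mem_filter] at hs
        exact ⟨(hT s hs.1).1, hs.2, (hT s hs.1).2⟩
  rw [← Finset.sum_filter_add_sum_filter_not T fun s => s 3 = 0]
  refine (abs_add_le _ _).trans ((add_le_add h1 h2).trans ?_)
  rw [← Nat.cast_add]
  refine Nat.cast_le.mpr ?_
  have h3 : (2 * (1 + 1)) ^ D.card ≤ 6 ^ D.card := Nat.pow_le_pow_left (by norm_num) _
  have h4 : Nat.card F ^ (3 * ℓ - 3 * k + 3) ≤ Nat.card F ^ (3 * ℓ - 3 * k + 5) :=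
    Nat.pow_le_pow_right Nat.card_pos (by omega)
  have h5 := Nat.mul_le_mul h3 h4
  norm_num at h5 ⊢
  linarith

theorem abs_adjustedRootCountingFunction_sub_le (D : Finset (ClosedPoint F)) {ℓ k : ℕ}
    (hk : 3 * k ≤ ℓ) (hD : divisorDegree D + 5 * k ≤ 2 * ℓ) [Fintype (cubicForms F ℓ k)] :
    |adjustedRootCountingFunction F ℓ k D - ∑ s : cubicForms F ℓ k, adjustedRootCount D s.1|
      ≤ ((6 ^ D.card * (3 * Nat.card F ^ (3 * ℓ - 3 * k + 5)) : ℕ) : ℤ) := by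
  classical
  let V : Finset (Fin 4 → MvPolynomial (Fin 2) F) := (cubicForms F ℓ k : Set _).toFinset
  have hV : ∑ s : cubicForms F ℓ k, adjustedRootCount D s.1 = ∑ s ∈ V, adjustedRootCount D s :=
    (Finset.sum_subtype V (by simp [V]) (adjustedRootCount D)).symm
  have hirr : adjustedRootCountingFunction F ℓ k D
      = ∑ s ∈ V with ¬ HorizontallyReducible k s, adjustedRootCount D s := by
    refine Finset.sum_congr (Finset.ext fun s => ?_) fun _ _ => rfl
    simp [V, irreducibleCubicForms]
  have hred := abs_sum_reducible_le D hk hD (T := V.filter fun s => HorizontallyReducible k s)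
    fun s hs => by simpa [V] using hs
  rw [hV, hirr, ← Finset.sum_filter_add_sum_filter_not V (HorizontallyReducible k),
    sub_add_cancel_right, abs_neg]
  exact hred

end Main

end HirzebruchCubic

end

theorem mainTheorem6 (F : Type*) [Field F] [Finite F] :
    ∃ K : ℝ, ∀ (ℓ k : ℕ) (D : Finset (HirzebruchCubic.ClosedPoint F)),
      3 * k ≤ ℓ →
      ((HirzebruchCubic.divisorDegree D : ℝ) + k) / 2 ≤ (ℓ : ℝ) - 2 * k →
      |(HirzebruchCubic.adjustedRootCountingFunction F ℓ k D : ℝ) -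
          (Nat.card F : ℝ) ^
            (4 * (ℓ : ℤ) - 6 * (k : ℤ) + 4 - (HirzebruchCubic.divisorDegree D : ℤ))| ≤
        K * ((6 : ℝ) ^ D.card * (Nat.card F : ℝ) ^ (3 * (ℓ : ℤ) - 3 * (k : ℤ))) := by
  classical
  have hq1 : (1 : ℝ) ≤ Nat.card F := by exact_mod_cast Nat.card_pos
  -- The first summand comes from nonzero orthogonal families, the second from reducible forms.
  refine ⟨3 * (Nat.card F : ℝ) ^ 6 + 3 * (Nat.card F : ℝ) ^ 5, fun ℓ k D hk hD => ?_⟩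
  have hD' : HirzebruchCubic.divisorDegree D + 5 * k ≤ 2 * ℓ := by
    have : (HirzebruchCubic.divisorDegree D : ℝ) + 5 * k ≤ 2 * ℓ := by linarith
    exact_mod_cast this
  have := Fintype.ofFinite (HirzebruchCubic.cubicForms F ℓ k)
  have h1 := HirzebruchCubic.abs_sum_cubicForms_sub_le D hk hD'
  have h2 := HirzebruchCubic.abs_adjustedRootCountingFunction_sub_le D hk hD'
  set A := ∑ s : HirzebruchCubic.cubicForms F ℓ k, HirzebruchCubic.adjustedRootCount D s.1
  have h2' : |(HirzebruchCubic.adjustedRootCountingFunction F ℓ k D : ℝ) - A|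
      ≤ 6 ^ D.card * (3 * (Nat.card F : ℝ) ^ (3 * ℓ - 3 * k + 5)) := by
    exact_mod_cast h2
  have e : (Nat.card F : ℝ) ^ (3 * ℓ - 3 * k + 5)
      = (Nat.card F : ℝ) ^ 5 * (Nat.card F : ℝ) ^ (3 * (ℓ : ℤ) - 3 * (k : ℤ)) := by
    rw [pow_add, mul_comm, ← zpow_natCast _ (3 * ℓ - 3 * k)]
    congr 2
    omega
  rw [e] at h2'
  have h6 : (1 : ℝ) ≤ 6 ^ D.card := one_le_pow₀ (by norm_num)
  have hQ : 0 ≤ 3 * (Nat.card F : ℝ) ^ 6 * (Nat.card F : ℝ) ^ (3 * (ℓ : ℤ) - 3 * (k : ℤ)) := by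
    positivity
  have h7 := mul_le_mul_of_nonneg_right h6 hQ
  have h8 := abs_sub_le (HirzebruchCubic.adjustedRootCountingFunction F ℓ k D : ℝ) A
    ((Nat.card F : ℝ) ^ (4 * (ℓ : ℤ) - 6 * (k : ℤ) + 4 - (HirzebruchCubic.divisorDegree D : ℤ)))
  linarith
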